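/- \textbf{Setting.} Let $\mathcal E,\mathcal A\in\mathbb R^{n\times n}$, $\mathcal B\in\mathbb R^{n\times m}$, $\mathcal C\in\mathbb R^{k\times n}$, $\mathcal F\in\mathbb R^{\ell\times n}$, $x_0\in\mathbb R^n$, $y_c\in\mathbb R^k$, $y_e\in\mathbb R^\ell$. For $t_1>0$ consider the problem $$\tfrac12\int_0^{t_1}\|\mathcal C x(s)-y_c\|^2+\|u(s)\|^2\,ds+\tfrac12\|\mathcal F x(t_1)-y_e\|^2\to\min\quad\text{subject to}\quad \mathcal E\dot x=\mathcal A x+\mathcal B u,\ \ \mathcal E x(0)=\mathcal E x_0, \qquad (\ast)$$ over all $x,u\in L^2(0,t_1)$ such that $\mathcal E x$ is absolutely continuous and satisfies the equation. All norms are Euclidean and $M^*$ is the transpose, $M^{-*}=(M^{-1})^*$. \textbf{Assumptions.} (1) $\mathcal E=\begin{bmatrix} I&0\\0&0\end{bmatrix}$ with $I\in\mathbb R^{d\times d}$; all block partitions below are with respect to this splitting of $\mathbb R^n$, in particular $\mathcal A=\begin{bmatrix}A_{11}&A_{12}\\A_{21}&A_{22}\end{bmatrix}$, $\mathcal B=\begin{bmatrix}B_1\\B_2\end{bmatrix}$,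 $\mathcal C=\begin{bmatrix}C_1&C_2\end{bmatrix}$. (2) $(\mathcal E,\mathcal A)$ is regular, i.e. $s\mathcal E-\mathcal A$ is invertible for some $s\in\mathbb C$. (3) $\mathcal P_+\in\mathbb R^{n\times n}$ is a stabilizing solution of the generalized algebraic Riccati equation $$\mathcal A^*X+X^*\mathcal A-X^*\mathcal B\mathcal B^*X+\mathcal C^*\mathcal C=0,\qquad \mathcal E^*X=X^*\mathcal E,$$ i.e. with $\mathcal A_+:=\mathcal A-\mathcal B\mathcal B^*\mathcal P_+$ the pair $(\mathcal E,\mathcal A_+)$ is regular, impulse-free ($\operatorname{rank}\begin{bmatrix}\mathcal E&0\\\mathcal A_+&\mathcal E\end{bmatrix}=n+\operatorname{rank}\mathcal E$) and finite dynamics stable (all eigenvalues of the block $J$ in its Weierstrass canonical form $\bigl(\begin{bmatrix}I&0\\0&N\end{bmatrix},\begin{bmatrix}J&0\\0&I\end{bmatrix}\bigr)$, $N$ nilpotent, have negative real part). Write $\mathcal P_+=\begin{bmatrix}P_{+;1}&0\\P_{+;21}&P_{+;2}\end{bmatrix}$, $\mathcal A_+=\begin{bmatrix}A_{+;1}&A_{+;12}\\A_{+;21}&A_{+;2}\end{bmatrix}$;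 here $A_{+;2}$ is invertible. (4) $\operatorname{range}\mathcal F^*\subset\operatorname{range}\mathcal E^*$; let $S_1$ be the upper left $d\times d$ block of $\mathcal F^*\mathcal F$. (5) With $K_2:=A_{22}^*-P_{+;2}^*B_2B_2^*$ (which equals $A_{+;2}^*$) and $G:=C_2^*C_1+P_{+;2}^*A_{21}$, $$\tilde Q:=C_1^*C_1-G^*K_2^{-*}A_{21}-A_{21}^*K_2^{-1}G-G^*K_2^{-*}B_2B_2^*K_2^{-1}G\ \geq 0 .$$ (6) With $$\bar A:=A_{+;1}-A_{+;12}A_{+;2}^{-1}A_{+;21},\quad \bar B:=B_1-A_{+;12}A_{+;2}^{-1}B_2,\quad \bar C:=C_1-C_2A_{+;2}^{-1}A_{+;21},\quad \bar W:=\int_0^\infty e^{s\bar A}\bar B\bar B^*e^{s\bar A^*}ds,$$ the matrix $I+\bar W(S_1-P_{+;1})$ is invertible. \textbf{Claim.} The spectral abscissa $\bar\lambda$ of $\bar A$ (the maximum of the real parts of its eigenvalues; $-\infty$ if $d=0$) is negative, and for every $t_1>0$ problem $(\ast)$ has a solution $(x,u)$ with $x$ and $u$ continuous on $[0,t_1]$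 with the following property. Put $$x_{s;1}:=(\bar A^{-1}\bar B\bar B^*\bar A^{-*}\bar C^*+\bar A^{-1}\bar BB_2^*A_{+;2}^{-*}C_2^*)\,y_c,\qquad x_s:=\begin{bmatrix}x_{s;1}\\-A_{+;2}^{-1}A_{+;21}x_{s;1}+A_{+;2}^{-1}B_2(\bar B^*\bar A^{-*}\bar C^*+B_2^*A_{+;2}^{-*}C_2^*)y_c\end{bmatrix},$$ $$u_s:=-\mathcal B^*\mathcal P_+x_s-\bar B^*\bar A^{-*}\bar C^*y_c-B_2^*A_{+;2}^{-*}C_2^*y_c .$$ Let $\mu<0$ satisfy $\mu>\bar\lambda$, or let $\mu=\bar\lambda$ if all eigenvalues of $\bar A$ with real part $\bar\lambda$ are semisimple. Then there is a constant $K>0$, independent of $t_1$ and $t$, such that for all $t_1>0$ and all $t\in[0,t_1]$ $$\|x(t)-x_s\|\le K\bigl(e^{\mu t}+e^{\mu(t_1-t)}\bigr),\qquad \|u(t)-u_s\|\le K\bigl(e^{\mu t}+e^{\mu(t_1-t)}\bigr).$$ -/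

import Mathlib

open Matrix MeasureTheory

noncomputable section

namespace DescriptorLQ

/-! ### Matrix pencils -/

/-- A real matrix, regarded as a complex matrix. -/
def toC {α β : Type*} (M : Matrix α β ℝ) : Matrix α β ℂ :=
  M.map (algebraMap ℝ ℂ)

/-- The pair `(E, A)` is regular: `s E - A` is invertible for some complex `s`. -/
def IsRegularPair {ι : Type*} [Fintype ι] [DecidableEq ι] (E A : Matrix ι ι ℝ) : Prop :=
  ∃ s : ℂ, IsUnit (s • toC E - toC A)

/-- The pair `(E, A)` is impulse-free: `rank [E 0; A E] = n + rank E`. -/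
def IsImpulseFree {ι : Type*} [Fintype ι] [DecidableEq ι] (E A : Matrix ι ι ℝ) : Prop :=
  (fromBlocks E 0 A E).rank = Fintype.card ι + E.rank

/-- `(diag(I, N), diag(J, I))` with `N` nilpotent is a Weierstrass canonical form of `(E, A)`:
it is obtained from `(E, A)` by multiplication with invertible complex matrices `T` from the left
and `V` from the right. (`J` and `N` are determined up to similarity; bringing them into Jordan
form does not change their eigenvalues and is not required.) -/
def IsWeierstrassForm {ι : Type*} [Fintype ι] [DecidableEq ι] (E A : Matrix ι ι ℝ) {r p : ℕ}
    (J : Matrix (Fin r) (Fin r) ℂ) (N : Matrix (Fin p) (Fin p) ℂ) : Prop :=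
  IsNilpotent N ∧
  ∃ (T : Matrix (Fin r ⊕ Fin p) ι ℂ) (T' : Matrix ι (Fin r ⊕ Fin p) ℂ)
    (V : Matrix ι (Fin r ⊕ Fin p) ℂ) (V' : Matrix (Fin r ⊕ Fin p) ι ℂ),
    T * T' = 1 ∧ T' * T = 1 ∧ V * V' = 1 ∧ V' * V = 1 ∧
    T * toC E * V = fromBlocks 1 0 0 N ∧
    T * toC A * V = fromBlocks J 0 0 1

/-- The pair `(E, A)` is finite dynamics stable: all eigenvalues of the slow block `J` of its
Weierstrass canonical form have negative real part. -/
def IsFiniteDynamicsStable {ι : Type*} [Fintype ι] [DecidableEq ι] (E A : Matrix ι ι ℝ) : Prop :=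
  ∃ (r p : ℕ) (J : Matrix (Fin r) (Fin r) ℂ) (N : Matrix (Fin p) (Fin p) ℂ),
    IsWeierstrassForm E A J N ∧ ∀ z ∈ spectrum ℂ J, z.re < 0

/-- The closed loop matrix `A₊ = A - B Bᵀ P`. -/
def closedLoop {ι κ : Type*} [Fintype ι] [Fintype κ] (A : Matrix ι ι ℝ) (B : Matrix ι κ ℝ)
    (P : Matrix ι ι ℝ) : Matrix ι ι ℝ :=
  A - B * Bᵀ * P

/-- `P` is a stabilizing solution of the generalized algebraic Riccati equation
`Aᵀ X + Xᵀ A - Xᵀ B Bᵀ X + Cᵀ C = 0`, `Eᵀ X = Xᵀ E`. -/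
structure IsStabilizingSolution {ι κ γ : Type*} [Fintype ι] [DecidableEq ι] [Fintype κ]
    [Fintype γ] (E A : Matrix ι ι ℝ) (B : Matrix ι κ ℝ) (C : Matrix γ ι ℝ)
    (P : Matrix ι ι ℝ) : Prop where
  riccati : Aᵀ * P + Pᵀ * A - Pᵀ * B * Bᵀ * P + Cᵀ * C = 0
  symm : Eᵀ * P = Pᵀ * E
  regular : IsRegularPair E (closedLoop A B P)
  impulseFree : IsImpulseFree E (closedLoop A B P)
  stable : IsFiniteDynamicsStable E (closedLoop A B P)

/-! ### Spectral abscissa -/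

/-- The spectral abscissa of a real square matrix, i.e. the maximum of the real parts of its complex
eigenvalues (`⊥ = -∞` for the empty matrix). -/
def spectralAbscissa {ι : Type*} [Fintype ι] [DecidableEq ι] (M : Matrix ι ι ℝ) : EReal :=
  ⨆ z ∈ spectrum ℂ (toC M), ((z.re : ℝ) : EReal)

/-- Every eigenvalue of `M` whose real part is the spectral abscissa is semisimple, i.e. its
generalized eigenvectors are eigenvectors. -/
def DominantSemisimple {ι : Type*} [Fintype ι] [DecidableEq ι] (M : Matrix ι ι ℝ) : Prop :=
  ∀ z ∈ spectrum ℂ (toC M), ((z.re : ℝ) : EReal) = spectralAbscissa M →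
    ∀ v : ι → ℂ, (toC M - z • 1) *ᵥ ((toC M - z • 1) *ᵥ v) = 0 → (toC M - z • 1) *ᵥ v = 0

/-! ### The optimal control problem -/

/-- The Euclidean norm of a vector. -/
def enorm2 {ι : Type*} [Fintype ι] (v : ι → ℝ) : ℝ :=
  ‖WithLp.toLp 2 v‖

/-- `(x, u)` is admissible on `[0, t₁]`: `x` and `u` are square integrable and solve
`E x' = A x + B u`, `E x(0) = E x₀`, in the sense that `E x` is absolutely continuous with derivative
`A x + B u` and initial value `E x₀`. -/
structure IsAdmissible {ι κ : Type*} [Fintype ι] [Fintype κ] (E A : Matrix ι ι ℝ)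
    (B : Matrix ι κ ℝ) (x₀ : ι → ℝ) (t₁ : ℝ) (x : ℝ → ι → ℝ) (u : ℝ → κ → ℝ) : Prop where
  state_L2 : MemLp x 2 (volume.restrict (Set.Icc 0 t₁))
  control_L2 : MemLp u 2 (volume.restrict (Set.Icc 0 t₁))
  dae : ∀ t ∈ Set.Icc 0 t₁, E *ᵥ x t = E *ᵥ x₀ + ∫ s in (0 : ℝ)..t, (A *ᵥ x s + B *ᵥ u s)

/-- The cost functional
`½ ∫₀^{t₁} (‖C x - y_c‖² + ‖u‖²) ds + ½ ‖F x(t₁) - y_e‖²`. -/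
def cost {ι κ γ δ : Type*} [Fintype ι] [Fintype κ] [Fintype γ] [Fintype δ]
    (C : Matrix γ ι ℝ) (F : Matrix δ ι ℝ) (yc : γ → ℝ) (ye : δ → ℝ) (t₁ : ℝ)
    (x : ℝ → ι → ℝ) (u : ℝ → κ → ℝ) : ℝ :=
  1 / 2 * (∫ s in (0 : ℝ)..t₁, (enorm2 (C *ᵥ x s - yc) ^ 2 + enorm2 (u s) ^ 2))
    + 1 / 2 * enorm2 (F *ᵥ x t₁ - ye) ^ 2

/-- `(x, u)` solves the finite horizon optimal control problem on `[0, t₁]`. -/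
def IsOptimal {ι κ γ δ : Type*} [Fintype ι] [Fintype κ] [Fintype γ] [Fintype δ]
    (E A : Matrix ι ι ℝ) (B : Matrix ι κ ℝ) (C : Matrix γ ι ℝ) (F : Matrix δ ι ℝ)
    (x₀ : ι → ℝ) (yc : γ → ℝ) (ye : δ → ℝ) (t₁ : ℝ)
    (x : ℝ → ι → ℝ) (u : ℝ → κ → ℝ) : Prop :=
  IsAdmissible E A B x₀ t₁ x u ∧
  ∀ (x' : ℝ → ι → ℝ) (u' : ℝ → κ → ℝ), IsAdmissible E A B x₀ t₁ x' u' →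
    cost C F yc ye t₁ x u ≤ cost C F yc ye t₁ x' u'

/-! ### Reduced coefficients of a semi-explicit system

The state space splits into `d` differential and `q` algebraic variables. -/

section Reduced

variable {d q m k : ℕ}

/-- The upper block `B₁` of `B`. -/
def inputTop (B : Matrix (Fin d ⊕ Fin q) (Fin m) ℝ) : Matrix (Fin d) (Fin m) ℝ :=
  B.submatrix Sum.inl id

/-- The lower block `B₂` of `B`. -/
def inputBot (B : Matrix (Fin d ⊕ Fin q) (Fin m) ℝ) : Matrix (Fin q) (Fin m) ℝ :=
  B.submatrix Sum.inr id

/-- The left block `C₁` of `C`. -/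
def outputLeft (C : Matrix (Fin k) (Fin d ⊕ Fin q) ℝ) : Matrix (Fin k) (Fin d) ℝ :=
  C.submatrix id Sum.inl

/-- The right block `C₂` of `C`. -/
def outputRight (C : Matrix (Fin k) (Fin d ⊕ Fin q) ℝ) : Matrix (Fin k) (Fin q) ℝ :=
  C.submatrix id Sum.inr

/-- `K₂ = A₂₂ᵀ - P₂ᵀ B₂ B₂ᵀ`. -/
def K₂ (A : Matrix (Fin d ⊕ Fin q) (Fin d ⊕ Fin q) ℝ) (B : Matrix (Fin d ⊕ Fin q) (Fin m) ℝ)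
    (P : Matrix (Fin d ⊕ Fin q) (Fin d ⊕ Fin q) ℝ) : Matrix (Fin q) (Fin q) ℝ :=
  A.toBlocks₂₂ᵀ - P.toBlocks₂₂ᵀ * inputBot B * (inputBot B)ᵀ

/-- The matrix `Q̃` of the definiteness condition: with `G = C₂ᵀ C₁ + P₂ᵀ A₂₁`,
`Q̃ = C₁ᵀ C₁ - Gᵀ K₂⁻ᵀ A₂₁ - A₂₁ᵀ K₂⁻¹ G - Gᵀ K₂⁻ᵀ B₂ B₂ᵀ K₂⁻¹ G`. -/
def Qtilde (A : Matrix (Fin d ⊕ Fin q) (Fin d ⊕ Fin q) ℝ)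
    (B : Matrix (Fin d ⊕ Fin q) (Fin m) ℝ) (C : Matrix (Fin k) (Fin d ⊕ Fin q) ℝ)
    (P : Matrix (Fin d ⊕ Fin q) (Fin d ⊕ Fin q) ℝ) : Matrix (Fin d) (Fin d) ℝ :=
  let C₁ := outputLeft C
  let C₂ := outputRight C
  let B₂ := inputBot B
  let A₂₁ := A.toBlocks₂₁
  let P₂ := P.toBlocks₂₂
  let K := K₂ A B P
  C₁ᵀ * C₁ - (A₂₁ᵀ * P₂ + C₁ᵀ * C₂) * K⁻¹ᵀ * A₂₁ - A₂₁ᵀ * K⁻¹ * (C₂ᵀ * C₁ + P₂ᵀ * A₂₁)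
    - (C₁ᵀ * C₂ + A₂₁ᵀ * P₂) * K⁻¹ᵀ * B₂ * B₂ᵀ * K⁻¹ * (C₂ᵀ * C₁ + P₂ᵀ * A₂₁)

/-- `Ā = A₊₁ - A₊₁₂ A₊₂⁻¹ A₊₂₁`, as a function of `A₊`. -/
def Abar (Ap : Matrix (Fin d ⊕ Fin q) (Fin d ⊕ Fin q) ℝ) : Matrix (Fin d) (Fin d) ℝ :=
  Ap.toBlocks₁₁ - Ap.toBlocks₁₂ * Ap.toBlocks₂₂⁻¹ * Ap.toBlocks₂₁

/-- `B̄ = B₁ - A₊₁₂ A₊₂⁻¹ B₂`. -/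
def Bbar (Ap : Matrix (Fin d ⊕ Fin q) (Fin d ⊕ Fin q) ℝ)
    (B : Matrix (Fin d ⊕ Fin q) (Fin m) ℝ) : Matrix (Fin d) (Fin m) ℝ :=
  inputTop B - Ap.toBlocks₁₂ * Ap.toBlocks₂₂⁻¹ * inputBot B

/-- `C̄ = C₁ - C₂ A₊₂⁻¹ A₊₂₁`. -/
def Cbar (Ap : Matrix (Fin d ⊕ Fin q) (Fin d ⊕ Fin q) ℝ)
    (C : Matrix (Fin k) (Fin d ⊕ Fin q) ℝ) : Matrix (Fin k) (Fin d) ℝ :=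
  outputLeft C - outputRight C * Ap.toBlocks₂₂⁻¹ * Ap.toBlocks₂₁

/-- The reachability Gramian `∫₀^∞ e^{sM} G Gᵀ e^{sMᵀ} ds` (entrywise integral). -/
def gramian (M : Matrix (Fin d) (Fin d) ℝ) (G : Matrix (Fin d) (Fin m) ℝ) :
    Matrix (Fin d) (Fin d) ℝ :=
  Matrix.of fun i j =>
    ∫ s in Set.Ioi (0 : ℝ), (NormedSpace.exp (s • M) * G * Gᵀ * NormedSpace.exp (s • Mᵀ)) i j

/-- The differential part of the turnpike state,
`x_{s;1} = (Ā⁻¹ B̄ B̄ᵀ Ā⁻ᵀ C̄ᵀ + Ā⁻¹ B̄ B₂ᵀ A₊₂⁻ᵀ C₂ᵀ) y_c`. -/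
def turnpikeState₁ (Ap : Matrix (Fin d ⊕ Fin q) (Fin d ⊕ Fin q) ℝ)
    (B : Matrix (Fin d ⊕ Fin q) (Fin m) ℝ) (C : Matrix (Fin k) (Fin d ⊕ Fin q) ℝ)
    (yc : Fin k → ℝ) : Fin d → ℝ :=
  ((Abar Ap)⁻¹ * Bbar Ap B * (Bbar Ap B)ᵀ * (Abar Ap)⁻¹ᵀ * (Cbar Ap C)ᵀ
    + (Abar Ap)⁻¹ * Bbar Ap B * (inputBot B)ᵀ * Ap.toBlocks₂₂⁻¹ᵀ * (outputRight C)ᵀ) *ᵥ yc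

/-- The turnpike state `x_s`, whose algebraic part is
`-A₊₂⁻¹ A₊₂₁ x_{s;1} + A₊₂⁻¹ B₂ (B̄ᵀ Ā⁻ᵀ C̄ᵀ + B₂ᵀ A₊₂⁻ᵀ C₂ᵀ) y_c`. -/
def turnpikeState (Ap : Matrix (Fin d ⊕ Fin q) (Fin d ⊕ Fin q) ℝ)
    (B : Matrix (Fin d ⊕ Fin q) (Fin m) ℝ) (C : Matrix (Fin k) (Fin d ⊕ Fin q) ℝ)
    (yc : Fin k → ℝ) : Fin d ⊕ Fin q → ℝ :=
  Sum.elim (turnpikeState₁ Ap B C yc)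
    (-((Ap.toBlocks₂₂⁻¹ * Ap.toBlocks₂₁) *ᵥ turnpikeState₁ Ap B C yc)
      + (Ap.toBlocks₂₂⁻¹ * inputBot B *
          ((Bbar Ap B)ᵀ * (Abar Ap)⁻¹ᵀ * (Cbar Ap C)ᵀ
            + (inputBot B)ᵀ * Ap.toBlocks₂₂⁻¹ᵀ * (outputRight C)ᵀ)) *ᵥ yc)

/-- The turnpike control
`u_s = -Bᵀ P₊ x_s - B̄ᵀ Ā⁻ᵀ C̄ᵀ y_c - B₂ᵀ A₊₂⁻ᵀ C₂ᵀ y_c`. -/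
def turnpikeControl (Ap : Matrix (Fin d ⊕ Fin q) (Fin d ⊕ Fin q) ℝ)
    (B : Matrix (Fin d ⊕ Fin q) (Fin m) ℝ) (C : Matrix (Fin k) (Fin d ⊕ Fin q) ℝ)
    (P : Matrix (Fin d ⊕ Fin q) (Fin d ⊕ Fin q) ℝ) (yc : Fin k → ℝ) : Fin m → ℝ :=
  -((Bᵀ * P) *ᵥ turnpikeState Ap B C yc)
    - ((Bbar Ap B)ᵀ * (Abar Ap)⁻¹ᵀ * (Cbar Ap C)ᵀ) *ᵥ yc
    - ((inputBot B)ᵀ * Ap.toBlocks₂₂⁻¹ᵀ * (outputRight C)ᵀ) *ᵥ yc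

end Reduced

end DescriptorLQ

end

open Set Filter Topology

namespace DescriptorLQ

/-! ### Calculus of vector-valued curves -/

section Calculus

variable {ι κ : Type*} [Fintype ι]

/-! The problem is convex, so a state, control and costate satisfying the first order conditions
form a solution (`IsExtremal.isOptimal`). The proof constructs such a triple explicitly.

The ansatz `P x + π` for the costate turns these conditions into the closed loop for `x` with input
`v = -Bᵀ π` and an adjoint equation for `π` alone; the Riccati equation cancels all terms in `x`.
Impulse-freeness makes the algebraic block of `A₊` invertible
(`IsImpulseFree.isUnit_det_toBlocks₂₂`), so the algebraic variables can be eliminated. What remains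
is `x₁' = Ā x₁ + B̄ v` and `p' = C̄ᵀ y_c - Āᵀ p` with `Ā` stable
(`IsFiniteDynamicsStable.re_lt_zero`). The equilibrium of this system is the turnpike.

The deviation from the equilibrium is explicit: the costate part is `e^{(T-t)Āᵀ} g`, and the
Lyapunov equation of the Gramian `W` (`gramian_lyapunov`) gives the state part as `e^{tĀ}(ξ + W
e^{TĀᵀ} g)` minus `W` times the costate part. With `H = S₁ - P₁` and `W_T = W - e^{TĀ} W e^{TĀᵀ}`,
the terminal condition reads `(1 + H W_T) g = b_T` with `b_T` bounded in `T`.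

This matrix is invertible for each `T` because a homogeneous extremal vanishes (`isUnit_boundary`).
As `T → ∞` it tends to `1 + H W`, which is invertible by assumption, so its inverses are bounded
uniformly in `T` (`exists_bound_inv_mulVec`), and so is `g`. The estimates then follow from the
growth of the matrix exponential (`DominatesSpectrum.exists_bound`). -/

theorem enorm2_sq (v : ι → ℝ) : enorm2 v ^ 2 = v ⬝ᵥ v := by
  rw [enorm2, EuclideanSpace.real_norm_sq_eq]
  simp [dotProduct, sq]

theorem hasDerivAt_mulVec [Finite κ] {𝕜 : Type*} [RCLike 𝕜] (M : Matrix κ ι 𝕜) {f : ℝ → ι → 𝕜} {f' : ι → 𝕜}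
    {t : ℝ} (h : HasDerivAt f f' t) : HasDerivAt (fun s => M *ᵥ f s) (M *ᵥ f') t := by
  have := Fintype.ofFinite κ
  rw [hasDerivAt_pi] at h ⊢
  intro i
  simp only [mulVec, dotProduct]
  exact HasDerivAt.fun_sum fun j _ => (h j).const_mul (M i j)

theorem hasDerivAt_dotProduct {f g : ℝ → ι → ℝ} {f' g' : ι → ℝ} {t : ℝ}
    (hf : HasDerivAt f f' t) (hg : HasDerivAt g g' t) :
    HasDerivAt (fun s => f s ⬝ᵥ g s) (f' ⬝ᵥ g t + f t ⬝ᵥ g') t := by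
  rw [hasDerivAt_pi] at hf hg
  simp only [dotProduct, ← Finset.sum_add_distrib]
  exact HasDerivAt.fun_sum fun j _ => (hf j).mul (hg j)

/-- Integration by parts when one factor is the primitive of a merely integrable `w`: that factor is
absolutely continuous and has derivative `w` only almost everywhere. Competitors in the control
problem have no better regularity. -/
theorem integral_mul_add_deriv_mul_primitive {l l' w : ℝ → ℝ} {T : ℝ}
    (hl : ∀ t, HasDerivAt l (l' t) t) (hl' : Continuous l')
    (hw : IntervalIntegrable w volume 0 T) :
    ∫ t in (0 : ℝ)..T, (l t * w t + l' t * ∫ s in (0 : ℝ)..t, w s)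
      = l T * ∫ s in (0 : ℝ)..T, w s := by
  set y : ℝ → ℝ := fun t => ∫ s in (0 : ℝ)..t, w s with hy
  have hderiv : deriv l = l' := funext fun t => (hl t).deriv
  have hlc : Continuous l := continuous_iff_continuousAt.2 fun t => (hl t).continuousAt
  have hl1 : ContDiff ℝ 1 l :=
    contDiff_one_iff_deriv.2 ⟨fun t => (hl t).differentiableAt, hderiv ▸ hl'⟩
  have hyac : AbsolutelyContinuousOnInterval y 0 T :=
    hw.absolutelyContinuousOnInterval_intervalIntegral left_mem_uIcc
  have hparts := hl1.contDiffOn.absolutelyContinuousOnInterval.integral_mul_deriv_eq_deriv_mul hyac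
  have hcongr : ∫ t in (0 : ℝ)..T, l t * deriv y t = ∫ t in (0 : ℝ)..T, l t * w t := by
    refine intervalIntegral.integral_congr_ae ?_
    filter_upwards [hw.ae_hasDerivAt_integral] with t ht hmem
    rw [(ht (uIoc_subset_uIcc hmem) 0 left_mem_uIcc).deriv]
  have hint₁ : IntervalIntegrable (fun t => l t * w t) volume 0 T :=
    hw.continuousOn_mul hlc.continuousOn
  have hint₂ : IntervalIntegrable (fun t => l' t * y t) volume 0 T :=
    (hl'.continuousOn.mul hyac.continuousOn).intervalIntegrable
  rw [intervalIntegral.integral_add hint₁ hint₂, ← hcongr, hparts, hderiv]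
  simp [hy]

theorem integral_dotProduct_add_deriv_dotProduct_primitive {l l' w : ℝ → ι → ℝ} {T : ℝ}
    (hl : ∀ t, HasDerivAt l (l' t) t) (hl' : Continuous l')
    (hw : IntervalIntegrable w volume 0 T) :
    ∫ t in (0 : ℝ)..T, (l t ⬝ᵥ w t + l' t ⬝ᵥ ∫ s in (0 : ℝ)..t, w s)
      = l T ⬝ᵥ ∫ s in (0 : ℝ)..T, w s := by
  have hlc : Continuous l := continuous_iff_continuousAt.2 fun t => (hl t).continuousAt
  have hwi (i : ι) : IntervalIntegrable (fun t => w t i) volume 0 T :=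
    ⟨hw.1.eval i, hw.2.eval i⟩
  have hval {t : ℝ} (ht : t ∈ uIcc 0 T) (i : ι) :
      (∫ s in (0 : ℝ)..t, w s) i = ∫ s in (0 : ℝ)..t, w s i := by
    have h := hw.mono_set (uIcc_subset_uIcc_left ht)
    exact ((ContinuousLinearMap.proj (R := ℝ) (φ := fun _ : ι => ℝ) i).intervalIntegral_comp_comm
      h).symm
  have hcongr : ∫ t in (0 : ℝ)..T, (l t ⬝ᵥ w t + l' t ⬝ᵥ ∫ s in (0 : ℝ)..t, w s)
      = ∫ t in (0 : ℝ)..T, ∑ i, (l t i * w t i + l' t i * ∫ s in (0 : ℝ)..t, w s i) := by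
    refine intervalIntegral.integral_congr fun t ht => ?_
    simp only [dotProduct, ← Finset.sum_add_distrib, hval ht]
  rw [hcongr, intervalIntegral.integral_finsetSum]
  · simp only [dotProduct, hval right_mem_uIcc]
    exact Finset.sum_congr rfl fun i _ => integral_mul_add_deriv_mul_primitive
      (fun t => (hasDerivAt_pi.1 (hl t)) i) ((continuous_apply i).comp hl') (hwi i)
  · intro i _
    have hlci : Continuous fun t => l t i := (continuous_apply i).comp hlc
    have hlci' : Continuous fun t => l' t i := (continuous_apply i).comp hl'
    exact ((hwi i).continuousOn_mul hlci.continuousOn).add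
      (hlci'.continuousOn.mul
        ((hwi i).absolutelyContinuousOnInterval_intervalIntegral
          left_mem_uIcc).continuousOn).intervalIntegrable

end Calculus

/-! ### Extremals of the control problem -/

section Extremal

variable {ι κ γ δ : Type*} [Fintype ι] [Fintype κ] [Fintype γ] [Fintype δ]

/-- A state `x`, a control `u` and a costate `l` satisfying the first order optimality conditions of
the control problem on `[0, t₁]`, with `x'` and `l'` the derivatives of `x` and `l`. -/
structure IsExtremal (E A : Matrix ι ι ℝ) (B : Matrix ι κ ℝ) (C : Matrix γ ι ℝ)
    (F : Matrix δ ι ℝ) (x₀ : ι → ℝ) (yc : γ → ℝ) (ye : δ → ℝ) (t₁ : ℝ)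
    (x x' : ℝ → ι → ℝ) (u : ℝ → κ → ℝ) (l l' : ℝ → ι → ℝ) : Prop where
  state_deriv : ∀ t, HasDerivAt x (x' t) t
  control_cont : Continuous u
  costate_deriv : ∀ t, HasDerivAt l (l' t) t
  costate_deriv_cont : Continuous l'
  dae : ∀ t, E *ᵥ x' t = A *ᵥ x t + B *ᵥ u t
  init : E *ᵥ x 0 = E *ᵥ x₀
  adjoint : ∀ t, Eᵀ *ᵥ l' t = -(Aᵀ *ᵥ l t) - Cᵀ *ᵥ (C *ᵥ x t - yc)
  control : ∀ t, u t = -(Bᵀ *ᵥ l t)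
  transversality : Eᵀ *ᵥ l t₁ = Fᵀ *ᵥ (F *ᵥ x t₁ - ye)

variable {E A : Matrix ι ι ℝ} {B : Matrix ι κ ℝ} {C : Matrix γ ι ℝ} {F : Matrix δ ι ℝ}
  {x₀ : ι → ℝ} {yc : γ → ℝ} {ye : δ → ℝ} {t₁ : ℝ}
  {x x' : ℝ → ι → ℝ} {u : ℝ → κ → ℝ} {l l' : ℝ → ι → ℝ}

theorem transpose_mulVec_dotProduct {α β : Type*} [Fintype α] [Fintype β] (M : Matrix α β ℝ)
    (v : α → ℝ) (w : β → ℝ) : (Mᵀ *ᵥ v) ⬝ᵥ w = v ⬝ᵥ (M *ᵥ w) := by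
  rw [mulVec_transpose, dotProduct_mulVec]

theorem IsExtremal.continuous_state (h : IsExtremal E A B C F x₀ yc ye t₁ x x' u l l') :
    Continuous x :=
  continuous_iff_continuousAt.2 fun t => (h.state_deriv t).continuousAt

theorem memLp_two_of_continuous {f : ℝ → ι → ℝ} (hf : Continuous f) (a b : ℝ) :
    MemLp f 2 (volume.restrict (Icc a b)) := by
  obtain ⟨K, hK⟩ := isCompact_Icc.exists_bound_of_continuousOn (s := Icc a b) hf.continuousOn
  exact MemLp.of_bound hf.aestronglyMeasurable K
    ((ae_restrict_iff' measurableSet_Icc).2 (Eventually.of_forall hK))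

theorem IsExtremal.isAdmissible (h : IsExtremal E A B C F x₀ yc ye t₁ x x' u l l') :
    IsAdmissible E A B x₀ t₁ x u where
  state_L2 := memLp_two_of_continuous h.continuous_state 0 t₁
  control_L2 := memLp_two_of_continuous h.control_cont 0 t₁
  dae t _ := by
    have hd (s : ℝ) : HasDerivAt (fun s => E *ᵥ x s) (A *ᵥ x s + B *ᵥ u s) s := by
      rw [← h.dae s]; exact hasDerivAt_mulVec E (h.state_deriv s)
    have hc : Continuous fun s => A *ᵥ x s + B *ᵥ u s :=
      (Continuous.matrix_mulVec continuous_const h.continuous_state).add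
        (Continuous.matrix_mulVec continuous_const h.control_cont)
    rw [intervalIntegral.integral_eq_sub_of_hasDerivAt (fun s _ => hd s)
      (hc.intervalIntegrable _ _), h.init]
    abel

theorem memLp_mulVec {μ : Measure ℝ} {p : ENNReal} {f : ℝ → ι → ℝ} (hf : MemLp f p μ)
    (M : Matrix κ ι ℝ) : MemLp (fun t => M *ᵥ f t) p μ :=
  (M.mulVecLin.toContinuousLinearMap).comp_memLp' hf

theorem integrable_dotProduct {μ : Measure ℝ} {f g : ℝ → ι → ℝ} (hf : MemLp f 2 μ)
    (hg : MemLp g 2 μ) : Integrable (fun t => f t ⬝ᵥ g t) μ := by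
  simp only [dotProduct]
  exact integrable_finsetSum _ fun i _ => (hf.eval i).integrable_mul (hg.eval i)

theorem IsAdmissible.intervalIntegrable_rhs (ht₁ : 0 ≤ t₁) (h : IsAdmissible E A B x₀ t₁ x u) :
    IntervalIntegrable (fun s => A *ᵥ x s + B *ᵥ u s) volume 0 t₁ := by
  rw [intervalIntegrable_iff_integrableOn_Icc_of_le ht₁]
  exact ((memLp_mulVec h.state_L2 A).add (memLp_mulVec h.control_L2 B)).integrable (by norm_num)

theorem dotProduct_self_ge (a b c : ι → ℝ) (hab : b = a + c) :
    a ⬝ᵥ a + 2 * (a ⬝ᵥ c) ≤ b ⬝ᵥ b := by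
  have hc : 0 ≤ c ⬝ᵥ c := Finset.sum_nonneg fun i _ => mul_self_nonneg (c i)
  rw [hab]
  simp only [add_dotProduct, dotProduct_add, dotProduct_comm c a]
  linarith

/-- Since the control problem is convex, the first order conditions are sufficient. -/
theorem IsExtremal.isOptimal (ht₁ : 0 ≤ t₁) (h : IsExtremal E A B C F x₀ yc ye t₁ x x' u l l') :
    IsOptimal E A B C F x₀ yc ye t₁ x u := by
  have hadm := h.isAdmissible
  refine ⟨hadm, fun X U hX => ?_⟩
  set ξ : ℝ → ι → ℝ := fun t => X t - x t with hξ
  set ω : ℝ → κ → ℝ := fun t => U t - u t with hω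
  set w : ℝ → ι → ℝ := fun t => A *ᵥ ξ t + B *ᵥ ω t with hw
  have hsplit : w = fun s => (A *ᵥ X s + B *ᵥ U s) - (A *ᵥ x s + B *ᵥ u s) := by
    funext s; simp only [hw, hξ, hω, mulVec_sub]; abel
  have hwint : IntervalIntegrable w volume 0 t₁ :=
    hsplit ▸ (hX.intervalIntegrable_rhs ht₁).sub (hadm.intervalIntegrable_rhs ht₁)
  have hEξ {t : ℝ} (ht : t ∈ Icc 0 t₁) : E *ᵥ ξ t = ∫ s in (0 : ℝ)..t, w s := by
    have hsub : uIcc 0 t ⊆ uIcc 0 t₁ := uIcc_subset_uIcc_left (by rwa [uIcc_of_le ht₁])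
    rw [hsplit, intervalIntegral.integral_sub ((hX.intervalIntegrable_rhs ht₁).mono_set hsub)
      ((hadm.intervalIntegrable_rhs ht₁).mono_set hsub)]
    simp only [hξ, mulVec_sub, hX.dae t ht, hadm.dae t ht]
    abel
  -- By the adjoint and control equations, the integrand of the first variation is minus the formal
  -- derivative of `l · E ξ`.
  have hlin (t : ℝ) : (C *ᵥ x t - yc) ⬝ᵥ (C *ᵥ ξ t) + u t ⬝ᵥ ω t
      = -(l t ⬝ᵥ w t + l' t ⬝ᵥ (E *ᵥ ξ t)) := by
    have h1 : Cᵀ *ᵥ (C *ᵥ x t - yc) = -(Aᵀ *ᵥ l t) - Eᵀ *ᵥ l' t := by rw [h.adjoint t]; abel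
    rw [← transpose_mulVec_dotProduct C, h1, h.control t, ← transpose_mulVec_dotProduct E]
    simp only [hw, sub_dotProduct, neg_dotProduct, dotProduct_add, transpose_mulVec_dotProduct]
    ring
  have hparts := integral_dotProduct_add_deriv_dotProduct_primitive h.costate_deriv
    h.costate_deriv_cont hwint
  -- The first variation vanishes: `E ξ` is zero at time `0`, and transversality cancels the
  -- boundary term at `t₁`.
  have hzero : (∫ t in (0 : ℝ)..t₁, ((C *ᵥ x t - yc) ⬝ᵥ (C *ᵥ ξ t) + u t ⬝ᵥ ω t))
      + (F *ᵥ x t₁ - ye) ⬝ᵥ (F *ᵥ ξ t₁) = 0 := by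
    have hcongr : (∫ t in (0 : ℝ)..t₁, ((C *ᵥ x t - yc) ⬝ᵥ (C *ᵥ ξ t) + u t ⬝ᵥ ω t))
        = -∫ t in (0 : ℝ)..t₁, (l t ⬝ᵥ w t + l' t ⬝ᵥ ∫ s in (0 : ℝ)..t, w s) := by
      rw [← intervalIntegral.integral_neg]
      refine intervalIntegral.integral_congr fun t ht => ?_
      rw [uIcc_of_le ht₁] at ht
      simp only [hlin t, hEξ ht]
    rw [hcongr, hparts, ← hEξ (right_mem_Icc.2 ht₁), ← transpose_mulVec_dotProduct F,
      ← h.transversality, transpose_mulVec_dotProduct]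
    ring
  have hxL := hadm.state_L2
  have huL := hadm.control_L2
  have hξL : MemLp ξ 2 (volume.restrict (Icc 0 t₁)) := hX.state_L2.sub hxL
  have hωL : MemLp ω 2 (volume.restrict (Icc 0 t₁)) := hX.control_L2.sub huL
  have hout {z : ℝ → ι → ℝ} (hz : MemLp z 2 (volume.restrict (Icc 0 t₁))) :
      MemLp (fun t => C *ᵥ z t - yc) 2 (volume.restrict (Icc 0 t₁)) :=
    (memLp_mulVec hz C).sub (memLp_const yc)
  have hint₁ : IntervalIntegrable
      (fun t => (C *ᵥ x t - yc) ⬝ᵥ (C *ᵥ x t - yc) + u t ⬝ᵥ u t) volume 0 t₁ := by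
    rw [intervalIntegrable_iff_integrableOn_Icc_of_le ht₁]
    exact (integrable_dotProduct (hout hxL) (hout hxL)).add (integrable_dotProduct huL huL)
  have hint₂ : IntervalIntegrable
      (fun t => (C *ᵥ X t - yc) ⬝ᵥ (C *ᵥ X t - yc) + U t ⬝ᵥ U t) volume 0 t₁ := by
    rw [intervalIntegrable_iff_integrableOn_Icc_of_le ht₁]
    exact (integrable_dotProduct (hout hX.state_L2) (hout hX.state_L2)).add
      (integrable_dotProduct hX.control_L2 hX.control_L2)
  have hint₃ : IntervalIntegrable
      (fun t => (C *ᵥ x t - yc) ⬝ᵥ (C *ᵥ ξ t) + u t ⬝ᵥ ω t) volume 0 t₁ := by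
    rw [intervalIntegrable_iff_integrableOn_Icc_of_le ht₁]
    exact (integrable_dotProduct (hout hxL) (memLp_mulVec hξL C)).add
      (integrable_dotProduct huL hωL)
  have hmono := intervalIntegral.integral_mono_on ht₁ (hint₁.add (hint₃.const_mul 2)) hint₂
    fun t _ => by
      have h1 := dotProduct_self_ge (C *ᵥ x t - yc) (C *ᵥ X t - yc) (C *ᵥ ξ t)
        (by simp only [hξ, mulVec_sub]; abel)
      have h2 := dotProduct_self_ge (u t) (U t) (ω t) (by simp only [hω]; abel)
      linarith
  rw [intervalIntegral.integral_add hint₁ (hint₃.const_mul 2),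
    intervalIntegral.integral_const_mul] at hmono
  have hend := dotProduct_self_ge (F *ᵥ x t₁ - ye) (F *ᵥ X t₁ - ye) (F *ᵥ ξ t₁)
    (by simp only [hξ, mulVec_sub]; abel)
  simp only [cost, enorm2_sq]
  linarith

end Extremal

/-! ### Homogeneous extremals of a regular pair vanish -/

section Homogeneous

/-- Write the characteristic polynomial as `X ^ k * g` with `g(0) ≠ 0`. Cayley–Hamilton gives `g(M)
M ^ k = 0`, and solving for the constant term of `g` yields `R`. This `R` inverts `M` on the range
of `M ^ k` and stands in for the Weierstrass form of a regular pair. -/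
theorem exists_pow_eq_mul_pow_succ {ι : Type*} [Fintype ι] [DecidableEq ι] (M : Matrix ι ι ℂ) :
    ∃ (k : ℕ) (R : Matrix ι ι ℂ), M ^ k = R * M ^ (k + 1) := by
  obtain ⟨g, hg, hdvd⟩ := Polynomial.exists_eq_pow_rootMultiplicity_mul_and_not_dvd M.charpoly
    M.charpoly_monic.ne_zero 0
  have hc : g.coeff 0 ≠ 0 := by
    simpa [Polynomial.X_dvd_iff] using hdvd
  have hCH := M.aeval_self_charpoly
  rw [hg] at hCH
  set k := M.charpoly.rootMultiplicity 0
  refine ⟨k, -(g.coeff 0)⁻¹ • Polynomial.aeval M g.divX, ?_⟩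
  have hsplit : Polynomial.aeval M g
      = Polynomial.aeval M g.divX * M + g.coeff 0 • (1 : Matrix ι ι ℂ) := by
    conv_lhs => rw [← Polynomial.divX_mul_X_add g]
    rw [map_add, map_mul, Polynomial.aeval_X, Polynomial.aeval_C, Algebra.algebraMap_eq_smul_one]
  rw [mul_comm, map_zero, sub_zero, map_mul, map_pow, Polynomial.aeval_X, hsplit, add_mul,
    smul_mul_assoc, one_mul, mul_assoc, ← pow_succ'] at hCH
  rw [smul_mul_assoc, eq_neg_of_add_eq_zero_left hCH, smul_neg, neg_smul,
    neg_neg, smul_smul, inv_mul_cancel₀ hc, one_smul]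

theorem eq_zero_of_hasDerivAt_mulVec {ι : Type*} [Fintype ι] {K : Matrix ι ι ℂ} {w : ℝ → ι → ℂ}
    {T : ℝ} (hc : Continuous w) (hw : ∀ t ∈ Ico 0 T, HasDerivAt w (K *ᵥ w t) t) (h0 : w 0 = 0) :
    ∀ t ∈ Icc 0 T, w t = 0 := by
  refine eq_zero_of_abs_deriv_le_mul_abs_self_of_eq_zero_right
    (K := ‖K.mulVecLin.toContinuousLinearMap‖) hc.continuousOn
    (fun t ht => (hw t ht).hasDerivWithinAt) h0 fun t _ => ?_
  exact K.mulVecLin.toContinuousLinearMap.le_opNorm (w t)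

theorem toC_mulVec {ι κ : Type*} [Fintype ι] (M : Matrix κ ι ℝ) (v : ι → ℝ) :
    toC M *ᵥ (fun i => (v i : ℂ)) = fun i => ((M *ᵥ v) i : ℂ) := by
  funext i
  simp [toC, mulVec, dotProduct]

variable {ι κ γ δ : Type*} [Fintype ι] [DecidableEq ι] [Fintype κ] [Fintype γ] [Fintype δ]

/-- The initial value problem of a regular pair has at most one differentiable solution. -/
theorem IsRegularPair.eq_zero_of_solution {E A : Matrix ι ι ℝ} (h : IsRegularPair E A)
    {x x' : ℝ → ι → ℝ} {T : ℝ} (hT : 0 < T) (hx : ∀ t, HasDerivAt x (x' t) t)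
    (hode : ∀ t ∈ Icc 0 T, E *ᵥ x' t = A *ᵥ x t) (h0 : E *ᵥ x 0 = 0) :
    ∀ t ∈ Icc 0 T, x t = 0 := by
  obtain ⟨s, hs⟩ := h
  set S := s • toC E - toC A with hS
  have hSinv : S⁻¹ * S = 1 := nonsing_inv_mul _ ((isUnit_iff_isUnit_det _).1 hs)
  -- Multiplying by the inverse of `s E - A` leaves a single matrix: the equation becomes `M z' = s
  -- M z - z`.
  set M := S⁻¹ * toC E with hM
  have hMA : S⁻¹ * toC A = s • M - 1 := by
    rw [hM, ← mul_smul_comm, ← hSinv, ← mul_sub, hS, sub_sub_cancel]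
  set z : ℝ → ι → ℂ := fun t i => (x t i : ℂ) with hz
  set z' : ℝ → ι → ℂ := fun t i => (x' t i : ℂ) with hz'
  have hzd (t : ℝ) : HasDerivAt z (z' t) t :=
    hasDerivAt_pi.2 fun i => (hasDerivAt_pi.1 (hx t) i).ofReal_comp
  have hzc : Continuous z := continuous_iff_continuousAt.2 fun t => (hzd t).continuousAt
  have hMz (t : ℝ) (ht : t ∈ Icc 0 T) : M *ᵥ z' t = s • (M *ᵥ z t) - z t := by
    have h1 : toC E *ᵥ z' t = toC A *ᵥ z t := by
      rw [hz, hz', toC_mulVec, toC_mulVec, hode t ht]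
    rw [hM, ← mulVec_mulVec, h1, mulVec_mulVec, hMA, sub_mulVec, one_mulVec, smul_mulVec]
  have hz0 : M *ᵥ z 0 = 0 := by
    rw [hM, ← mulVec_mulVec, hz, toC_mulVec, h0]
    exact mulVec_zero _
  obtain ⟨k, R, hR⟩ := exists_pow_eq_mul_pow_succ M
  have hpow (j : ℕ) (t : ℝ) : HasDerivAt (fun t => M ^ j *ᵥ z t) (M ^ j *ᵥ z' t) t :=
    hasDerivAt_mulVec _ (hzd t)
  have hpowc (j : ℕ) : Continuous fun t => M ^ j *ᵥ z t :=
    continuous_iff_continuousAt.2 fun t => (hpow j t).continuousAt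
  have hpow' (j : ℕ) (t : ℝ) (ht : t ∈ Icc 0 T) :
      M ^ (j + 1) *ᵥ z' t = s • (M ^ (j + 1) *ᵥ z t) - M ^ j *ᵥ z t := by
    rw [pow_succ, ← mulVec_mulVec, hMz t ht, mulVec_sub, mulVec_smul, mulVec_mulVec]
  -- Since `M ^ k = R M ^ (k + 1)`, the curve `y = M ^ (k + 1) z` solves the ordinary differential
  -- equation `y' = (s - R) y` with `y(0) = 0`.
  have htop : ∀ t ∈ Icc 0 T, M ^ (k + 1) *ᵥ z t = 0 := by
    refine eq_zero_of_hasDerivAt_mulVec (K := s • 1 - R) (hpowc (k + 1)) (fun t ht => ?_) ?_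
    · convert hpow (k + 1) t using 1
      rw [hpow' k t (Ico_subset_Icc_self ht), sub_mulVec, smul_mulVec, one_mulVec, mulVec_mulVec,
        ← hR]
    · rw [pow_succ, ← mulVec_mulVec, hz0, mulVec_zero]
  -- Differentiating `M ^ (j + 1) z = 0` gives `M ^ j z = 0` in the open interval; continuity adds
  -- the endpoints.
  have hdown (j : ℕ) (hj : ∀ t ∈ Icc 0 T, M ^ (j + 1) *ᵥ z t = 0) :
      ∀ t ∈ Icc 0 T, M ^ j *ᵥ z t = 0 := by
    have hIoo : Ioo 0 T ⊆ {t | M ^ j *ᵥ z t = 0} := by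
      intro t ht
      have hev : (fun t => M ^ (j + 1) *ᵥ z t) =ᶠ[𝓝 t] fun _ => 0 := by
        filter_upwards [Icc_mem_nhds ht.1 ht.2] with r hr using hj r hr
      have hd := (hpow (j + 1) t).unique ((hasDerivAt_const t (0 : ι → ℂ)).congr_of_eventuallyEq hev)
      rw [hpow' j t (Ioo_subset_Icc_self ht), hj t (Ioo_subset_Icc_self ht), smul_zero,
        zero_sub, neg_eq_zero] at hd
      exact hd
    have hcl : IsClosed {t | M ^ j *ᵥ z t = 0} := isClosed_eq (hpowc j) continuous_const
    have := hcl.closure_subset_iff.2 hIoo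
    rwa [closure_Ioo hT.ne] at this
  have hall (j : ℕ) : (∀ t ∈ Icc 0 T, M ^ j *ᵥ z t = 0) → ∀ t ∈ Icc 0 T, z t = 0 := by
    induction j with
    | zero => intro hj t ht; simpa using hj t ht
    | succ j ih => exact fun hj => ih (hdown j hj)
  intro t ht
  funext i
  simpa [hz] using congrFun (hall (k + 1) htop t ht) i

theorem dotProduct_self_nonneg {α : Type*} [Fintype α] (v : α → ℝ) : 0 ≤ v ⬝ᵥ v :=
  Finset.sum_nonneg fun i _ => mul_self_nonneg (v i)

/-- The function `l · E x` has derivative `-|C x|² - |u|²`, starts at `0` and ends at `|F x(T)|² ≥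
0`. It is therefore constant, so `u = 0`, and regularity of the pair gives `x = 0`. -/
theorem IsExtremal.eq_zero_of_homogeneous {E A : Matrix ι ι ℝ} {B : Matrix ι κ ℝ}
    {C : Matrix γ ι ℝ} {F : Matrix δ ι ℝ} {T : ℝ} {x x' : ℝ → ι → ℝ} {u : ℝ → κ → ℝ}
    {l l' : ℝ → ι → ℝ} (hreg : IsRegularPair E A) (hT : 0 < T)
    (h : IsExtremal E A B C F 0 0 0 T x x' u l l') : ∀ t ∈ Icc 0 T, x t = 0 := by
  set h₀ : ℝ → ℝ := fun t => l t ⬝ᵥ (E *ᵥ x t)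
  have hd (t : ℝ) : HasDerivAt h₀ (-((C *ᵥ x t) ⬝ᵥ (C *ᵥ x t)) - u t ⬝ᵥ u t) t := by
    convert hasDerivAt_dotProduct (h.costate_deriv t) (hasDerivAt_mulVec E (h.state_deriv t))
      using 1
    have hu : u t ⬝ᵥ u t = -(l t ⬝ᵥ (B *ᵥ u t)) := by
      nth_rewrite 1 [h.control t]
      rw [neg_dotProduct, transpose_mulVec_dotProduct]
    rw [h.dae, ← transpose_mulVec_dotProduct E, h.adjoint, hu]
    simp only [sub_zero, sub_dotProduct, neg_dotProduct, dotProduct_add,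
      transpose_mulVec_dotProduct]
    ring
  have hanti : Antitone h₀ := antitone_of_hasDerivAt_nonpos hd fun t => by
    have h1 := dotProduct_self_nonneg (C *ᵥ x t)
    have h2 := dotProduct_self_nonneg (u t)
    simp only [Pi.zero_apply]
    linarith
  have hstart : h₀ 0 = 0 := by
    simp only [h₀, h.init, mulVec_zero, dotProduct_zero]
  have hend : 0 ≤ h₀ T := by
    simp only [h₀]
    rw [← transpose_mulVec_dotProduct, h.transversality, sub_zero, transpose_mulVec_dotProduct]
    exact dotProduct_self_nonneg _
  have hconst (t : ℝ) (ht : t ∈ Icc 0 T) : h₀ t = 0 :=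
    le_antisymm (hstart ▸ hanti ht.1) (hend.trans (hanti ht.2))
  have hIoo : Ioo 0 T ⊆ {t | u t = 0} := by
    intro t ht
    have hev : h₀ =ᶠ[𝓝 t] fun _ => 0 := by
      filter_upwards [Icc_mem_nhds ht.1 ht.2] with r hr using hconst r hr
    have hz := (hd t).unique ((hasDerivAt_const t (0 : ℝ)).congr_of_eventuallyEq hev)
    have h1 := dotProduct_self_nonneg (C *ᵥ x t)
    have h2 := dotProduct_self_nonneg (u t)
    exact dotProduct_self_eq_zero.1 (by linarith)
  have hcl : IsClosed {t | u t = 0} := isClosed_eq h.control_cont continuous_const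
  have hu := hcl.closure_subset_iff.2 hIoo
  rw [closure_Ioo hT.ne] at hu
  refine hreg.eq_zero_of_solution hT h.state_deriv (fun t ht => ?_) ?_
  · rw [h.dae, show u t = 0 from hu ht, mulVec_zero, add_zero]
  · rw [h.init, mulVec_zero]

end Homogeneous

/-! ### Growth of the matrix exponential -/

section Exponential

variable {ι : Type*} [Fintype ι] [DecidableEq ι]

open scoped Matrix.Norms.Operator in
theorem hasDerivAt_exp_smul_mulVec {𝕜 : Type*} [RCLike 𝕜] (M : Matrix ι ι 𝕜) (v : ι → 𝕜) (t : ℝ) :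
    HasDerivAt (fun s : ℝ => NormedSpace.exp (s • M) *ᵥ v)
      (NormedSpace.exp (t • M) *ᵥ (M *ᵥ v)) t := by
  let L : Matrix ι ι 𝕜 →L[ℝ] (ι → 𝕜) := LinearMap.toContinuousLinearMap
    { toFun := fun N => N *ᵥ v
      map_add' := fun N N' => add_mulVec N N' v
      map_smul' := fun c N => smul_mulVec c N v }
  have h := hasDerivAt_exp_smul_const (𝕂 := ℝ) M t
  rw [mulVec_mulVec]
  exact L.hasFDerivAt.comp_hasDerivAt t h

open scoped Matrix.Norms.Operator in
theorem exp_smul_mul_comm {𝕜 : Type*} [RCLike 𝕜] (M : Matrix ι ι 𝕜) (t : ℝ) :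
    NormedSpace.exp (t • M) * M = M * NormedSpace.exp (t • M) :=
  (((Commute.refl M).smul_left t).exp_left).eq

theorem hasDerivAt_exp_smul_mulVec' {𝕜 : Type*} [RCLike 𝕜] (M : Matrix ι ι 𝕜) (v : ι → 𝕜)
    (t : ℝ) :
    HasDerivAt (fun s : ℝ => NormedSpace.exp (s • M) *ᵥ v)
      (M *ᵥ (NormedSpace.exp (t • M) *ᵥ v)) t := by
  rw [mulVec_mulVec, ← exp_smul_mul_comm, ← mulVec_mulVec]
  exact hasDerivAt_exp_smul_mulVec M v t

/-- After scaling by `e^{-zt}`, differentiation replaces `v` by `(N - z) v`, which lowers the rank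
of a generalized eigenvector by one. -/
theorem hasDerivAt_scaled_exp_smul_mulVec (N : Matrix ι ι ℂ) (z : ℂ) (v : ι → ℂ) (t : ℝ) :
    HasDerivAt (fun s : ℝ => Complex.exp (-z * s) • (NormedSpace.exp (s • N) *ᵥ v))
      (Complex.exp (-z * t) • (NormedSpace.exp (t • N) *ᵥ ((N - z • 1) *ᵥ v))) t := by
  have h1 : HasDerivAt (fun s : ℝ => Complex.exp (-z * s)) (Complex.exp (-z * t) * (-z * 1)) t :=
    ((hasDerivAt_id t).ofReal_comp.const_mul (-z)).cexp
  refine (h1.smul (hasDerivAt_exp_smul_mulVec N v t)).congr_deriv ?_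
  rw [sub_mulVec, smul_mulVec, one_mulVec, mulVec_sub, mulVec_smul, smul_sub, sub_eq_add_neg,
    mul_one, smul_smul, mul_neg, neg_smul]

/-- Induction on the rank of the generalized eigenvector: the mean value inequality costs one factor
`1 + t` per step. -/
theorem exists_bound_scaled_exp {N : Matrix ι ι ℂ} {z : ℂ} (k : ℕ) :
    ∀ v : ι → ℂ, (N - z • 1) ^ (k + 1) *ᵥ v = 0 → ∃ K : ℝ, ∀ t : ℝ, 0 ≤ t →
      ‖Complex.exp (-z * t) • (NormedSpace.exp (t • N) *ᵥ v)‖ ≤ K * (1 + t) ^ k := by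
  have hmvt (v : ι → ℂ) (T C : ℝ) (hT : 0 ≤ T) (hC : ∀ t ∈ Ico 0 T,
      ‖Complex.exp (-z * t) • (NormedSpace.exp (t • N) *ᵥ ((N - z • 1) *ᵥ v))‖ ≤ C) :
      ‖Complex.exp (-z * T) • (NormedSpace.exp (T • N) *ᵥ v)‖ ≤ ‖v‖ + C * T := by
    have h := norm_image_sub_le_of_norm_deriv_le_segment'
      (fun t _ => (hasDerivAt_scaled_exp_smul_mulVec N z v t).hasDerivWithinAt) hC T
      (right_mem_Icc.2 hT)
    simp only [Complex.ofReal_zero, mul_zero, Complex.exp_zero, zero_smul, NormedSpace.exp_zero,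
      one_mulVec, one_smul, sub_zero] at h
    have := norm_le_norm_add_norm_sub' (Complex.exp (-z * T) • (NormedSpace.exp (T • N) *ᵥ v)) v
    linarith
  induction k with
  | zero =>
    intro v hv
    rw [zero_add, pow_one] at hv
    refine ⟨‖v‖, fun T hT => ?_⟩
    have := hmvt v T 0 hT fun t _ => by simp [hv]
    simpa using this
  | succ k ih =>
    intro v hv
    obtain ⟨K, hK⟩ := ih ((N - z • 1) *ᵥ v) (by rw [mulVec_mulVec, ← pow_succ, hv])
    refine ⟨‖v‖ + |K|, fun T hT => ?_⟩
    have h1 := hmvt v T (|K| * (1 + T) ^ k) hT fun t ht => (hK t ht.1).trans (by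
      have := ht.1
      have := ht.2
      gcongr
      exact le_abs_self K)
    have h2 : ‖v‖ ≤ ‖v‖ * (1 + T) ^ (k + 1) :=
      le_mul_of_one_le_right (norm_nonneg _) (one_le_pow₀ (by linarith))
    have h3 : |K| * (1 + T) ^ k * T ≤ |K| * (1 + T) ^ (k + 1) := by
      rw [pow_succ, mul_assoc]
      gcongr
      linarith
    linarith

theorem exists_one_add_pow_le_exp (k : ℕ) {a : ℝ} (ha : 0 < a) :
    ∃ K : ℝ, ∀ t : ℝ, 0 ≤ t → (1 + t) ^ k ≤ K * Real.exp (a * t) := by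
  -- From `s ^ k / k! ≤ e^s` at `s = a (1 + t)`.
  refine ⟨k.factorial / a ^ k * Real.exp a, fun t ht => ?_⟩
  have h := Real.pow_div_factorial_le_exp (a * (1 + t)) (by positivity) k
  rw [div_le_iff₀ (by positivity), mul_pow, mul_add, mul_one, Real.exp_add] at h
  rw [div_mul_eq_mul_div, div_mul_eq_mul_div, le_div_iff₀ (by positivity)]
  linarith

theorem norm_exp_mulVec_eq (N : Matrix ι ι ℂ) (z : ℂ) (v : ι → ℂ) (t : ℝ) :
    ‖NormedSpace.exp (t • N) *ᵥ v‖
      = Real.exp (z.re * t) * ‖Complex.exp (-z * t) • (NormedSpace.exp (t • N) *ᵥ v)‖ := by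
  rw [norm_smul, Complex.norm_exp, ← mul_assoc, ← Real.exp_add]
  simp

/-- `μ` dominates the growth of the exponential of `N`: every eigenvalue of `N` has real part less
than `μ`, or has real part `μ` and is semisimple. -/
def DominatesSpectrum (μ : ℝ) (N : Matrix ι ι ℂ) : Prop :=
  ∀ z ∈ spectrum ℂ N, z.re < μ ∨
    z.re = μ ∧ ∀ v : ι → ℂ, (N - z • 1) *ᵥ ((N - z • 1) *ᵥ v) = 0 → (N - z • 1) *ᵥ v = 0

theorem mulVec_eq_zero_of_pow_mulVec_eq_zero {M : Matrix ι ι ℂ}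
    (h : ∀ v : ι → ℂ, M *ᵥ (M *ᵥ v) = 0 → M *ᵥ v = 0) (k : ℕ) :
    ∀ v : ι → ℂ, M ^ (k + 1) *ᵥ v = 0 → M *ᵥ v = 0 := by
  induction k with
  | zero => intro v hv; simpa using hv
  | succ k ih =>
    intro v hv
    exact h v (ih (M *ᵥ v) (by rw [mulVec_mulVec, ← pow_succ, hv]))

/-- If `Re z < μ`, the gap absorbs the polynomial factor. If `Re z = μ`, semisimplicity makes `v` an
eigenvector or zero, so no polynomial factor arises. If `z` is not an eigenvalue, `v = 0`. -/
theorem DominatesSpectrum.exists_bound_of_pow_mulVec_eq_zero {μ : ℝ} {N : Matrix ι ι ℂ}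
    (h : DominatesSpectrum μ N) {z : ℂ} {k : ℕ} {v : ι → ℂ}
    (hv : (N - z • 1) ^ (k + 1) *ᵥ v = 0) :
    ∃ K : ℝ, ∀ t : ℝ, 0 ≤ t → ‖NormedSpace.exp (t • N) *ᵥ v‖ ≤ K * Real.exp (μ * t) := by
  by_cases hz : z ∈ spectrum ℂ N
  · rcases h z hz with hlt | ⟨rfl, hss⟩
    · obtain ⟨K, hK⟩ := exists_bound_scaled_exp k v hv
      obtain ⟨K', hK'⟩ := exists_one_add_pow_le_exp k (sub_pos.2 hlt)
      refine ⟨|K| * K', fun t ht => ?_⟩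
      rw [norm_exp_mulVec_eq N z]
      calc Real.exp (z.re * t) * ‖Complex.exp (-z * t) • (NormedSpace.exp (t • N) *ᵥ v)‖
          ≤ Real.exp (z.re * t) * (|K| * (K' * Real.exp ((μ - z.re) * t))) := by
            gcongr
            exact (hK t ht).trans (mul_le_mul (le_abs_self K) (hK' t ht) (by positivity)
              (abs_nonneg K))
        _ = |K| * K' * (Real.exp (z.re * t) * Real.exp ((μ - z.re) * t)) := by ring
        _ = |K| * K' * Real.exp (μ * t) := by rw [← Real.exp_add]; ring_nf
    · have hv1 := mulVec_eq_zero_of_pow_mulVec_eq_zero hss k v hv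
      obtain ⟨K, hK⟩ := exists_bound_scaled_exp 0 v (by simpa using hv1)
      refine ⟨K, fun t ht => ?_⟩
      rw [norm_exp_mulVec_eq N z, mul_comm K]
      gcongr
      simpa using hK t ht
  · rw [spectrum.notMem_iff, Algebra.algebraMap_eq_smul_one, ← neg_sub, IsUnit.neg_iff] at hz
    have hinj := mulVec_injective_of_isUnit (hz.pow (k + 1))
    have hv0 : v = 0 := hinj (by rw [hv, mulVec_zero])
    exact ⟨0, fun t _ => by simp [hv0]⟩

/-- The vectors obeying such a bound form a subspace, and it contains every generalized eigenspace;
over `ℂ` these span. -/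
theorem DominatesSpectrum.exists_bound_mulVec {μ : ℝ} {N : Matrix ι ι ℂ}
    (h : DominatesSpectrum μ N) (v : ι → ℂ) :
    ∃ K : ℝ, ∀ t : ℝ, 0 ≤ t → ‖NormedSpace.exp (t • N) *ᵥ v‖ ≤ K * Real.exp (μ * t) := by
  let S : Submodule ℂ (ι → ℂ) :=
    { carrier := {v | ∃ K : ℝ, ∀ t : ℝ, 0 ≤ t →
        ‖NormedSpace.exp (t • N) *ᵥ v‖ ≤ K * Real.exp (μ * t)}
      zero_mem' := ⟨0, fun t _ => by simp⟩
      add_mem' := by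
        rintro a b ⟨K, hK⟩ ⟨K', hK'⟩
        refine ⟨K + K', fun t ht => ?_⟩
        rw [mulVec_add, add_mul]
        exact (norm_add_le _ _).trans (add_le_add (hK t ht) (hK' t ht))
      smul_mem' := by
        rintro c a ⟨K, hK⟩
        refine ⟨‖c‖ * K, fun t ht => ?_⟩
        rw [mulVec_smul, norm_smul, mul_assoc]
        gcongr
        exact hK t ht }
  have htop : ⊤ ≤ S := by
    rw [← Module.End.iSup_maxGenEigenspace_eq_top (Matrix.toLin' N)]
    refine iSup_le fun z v hv => ?_
    rw [Module.End.mem_maxGenEigenspace] at hv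
    obtain ⟨k, hk⟩ := hv
    have hlin : Matrix.toLin' N - z • 1 = Matrix.toLin' (N - z • 1) := by
      rw [map_sub, map_smul, Matrix.toLin'_one]; rfl
    rw [hlin, ← Matrix.toLin'_pow, Matrix.toLin'_apply] at hk
    exact h.exists_bound_of_pow_mulVec_eq_zero (k := k)
      (by rw [pow_succ', ← mulVec_mulVec, hk, mulVec_zero])
  exact htop (Submodule.mem_top (x := v))

open scoped Matrix.Norms.Operator in
theorem toC_exp (M : Matrix ι ι ℝ) (t : ℝ) :
    toC (NormedSpace.exp (t • M)) = NormedSpace.exp (t • toC M) := by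
  let f : Matrix ι ι ℝ →ₐ[ℝ] Matrix ι ι ℂ := (Algebra.ofId ℝ ℂ).mapMatrix
  have hf : Continuous f := f.toLinearMap.continuous_of_finiteDimensional
  have h := NormedSpace.map_exp f hf (t • M)
  rw [map_smul] at h
  exact h

/-- The exponentials of `t M` and `t Mᵀ` grow at most as fast as `exp (μ t)`. -/
theorem DominatesSpectrum.exists_bound_entry {μ : ℝ} {M : Matrix ι ι ℝ}
    (h : DominatesSpectrum μ (toC M)) :
    ∃ K : ℝ, 0 ≤ K ∧ ∀ t : ℝ, 0 ≤ t → ∀ i j,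
      |NormedSpace.exp (t • M) i j| ≤ K * Real.exp (μ * t) := by
  choose K hK using fun j : ι => h.exists_bound_mulVec (Pi.single j 1)
  refine ⟨∑ j, |K j|, Finset.sum_nonneg fun j _ => abs_nonneg _, fun t ht i j => ?_⟩
  have h1 : |NormedSpace.exp (t • M) i j|
      ≤ ‖NormedSpace.exp (t • toC M) *ᵥ (Pi.single j 1 : ι → ℂ)‖ := by
    refine le_trans (le_of_eq ?_) (norm_le_pi_norm _ i)
    rw [mulVec_single_one, ← toC_exp]
    simp [toC]
  refine h1.trans ((hK j t ht).trans ?_)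
  gcongr
  exact (le_abs_self _).trans
    (Finset.single_le_sum (f := fun j => |K j|) (fun j _ => abs_nonneg _) (Finset.mem_univ j))

theorem norm_mulVec_le_of_entry_le {ι κ : Type*} [Fintype ι] [Fintype κ] {M : Matrix κ ι ℝ} {K : ℝ} (hK : 0 ≤ K)
    (h : ∀ i j, |M i j| ≤ K) (v : ι → ℝ) : ‖M *ᵥ v‖ ≤ Fintype.card ι * K * ‖v‖ := by
  refine (pi_norm_le_iff_of_nonneg (by positivity)).2 fun i => ?_
  calc ‖(M *ᵥ v) i‖ ≤ ∑ j, ‖M i j * v j‖ := norm_sum_le _ _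
    _ ≤ ∑ _j : ι, K * ‖v‖ := Finset.sum_le_sum fun j _ => by
        rw [norm_mul]
        exact mul_le_mul (h i j) (norm_le_pi_norm v j) (norm_nonneg _) hK
    _ = Fintype.card ι * K * ‖v‖ := by simp [mul_assoc]

/-- Bounding entries rather than vectors lets the transposed exponential inherit the same constant.
-/
theorem DominatesSpectrum.exists_bound {μ : ℝ} {M : Matrix ι ι ℝ}
    (h : DominatesSpectrum μ (toC M)) :
    ∃ K : ℝ, 0 ≤ K ∧ ∀ t : ℝ, 0 ≤ t → ∀ v : ι → ℝ,
      ‖NormedSpace.exp (t • M) *ᵥ v‖ ≤ K * Real.exp (μ * t) * ‖v‖ ∧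
      ‖NormedSpace.exp (t • Mᵀ) *ᵥ v‖ ≤ K * Real.exp (μ * t) * ‖v‖ := by
  obtain ⟨K, hK0, hK⟩ := h.exists_bound_entry
  refine ⟨Fintype.card ι * K, by positivity, fun t ht v => ⟨?_, ?_⟩⟩ <;> rw [mul_assoc _ K]
  · exact norm_mulVec_le_of_entry_le (by positivity) (hK t ht) v
  · refine norm_mulVec_le_of_entry_le (by positivity) (fun i j => ?_) v
    rw [← transpose_smul, exp_transpose]
    exact hK t ht j i

end Exponential

/-! ### The Lyapunov equation of the Gramian -/

section Gramian

variable {d m : ℕ}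

theorem exp_smul_transpose (M : Matrix (Fin d) (Fin d) ℝ) (t : ℝ) :
    NormedSpace.exp (t • Mᵀ) = (NormedSpace.exp (t • M))ᵀ := by
  rw [← transpose_smul, exp_transpose]

theorem hasDerivAt_gramian_integrand (M : Matrix (Fin d) (Fin d) ℝ) (Q : Matrix (Fin d) (Fin d) ℝ)
    (v w : Fin d → ℝ) (t : ℝ) :
    HasDerivAt (fun s : ℝ => (NormedSpace.exp (s • Mᵀ) *ᵥ v) ⬝ᵥ
        (Q *ᵥ (NormedSpace.exp (s • Mᵀ) *ᵥ w)))
      ((NormedSpace.exp (t • Mᵀ) *ᵥ (Mᵀ *ᵥ v)) ⬝ᵥ (Q *ᵥ (NormedSpace.exp (t • Mᵀ) *ᵥ w))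
        + (NormedSpace.exp (t • Mᵀ) *ᵥ v) ⬝ᵥ (Q *ᵥ (NormedSpace.exp (t • Mᵀ) *ᵥ (Mᵀ *ᵥ w)))) t :=
  hasDerivAt_dotProduct (hasDerivAt_exp_smul_mulVec _ _ _)
    (hasDerivAt_mulVec Q (hasDerivAt_exp_smul_mulVec _ _ _))

theorem abs_dotProduct_le (v w : Fin d → ℝ) : |v ⬝ᵥ w| ≤ d * ‖v‖ * ‖w‖ := by
  calc |v ⬝ᵥ w| ≤ ∑ i, |v i * w i| := Finset.abs_sum_le_sum_abs _ _
    _ ≤ ∑ _i : Fin d, ‖v‖ * ‖w‖ := Finset.sum_le_sum fun i _ => by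
        rw [abs_mul]
        exact mul_le_mul (norm_le_pi_norm v i) (norm_le_pi_norm w i) (abs_nonneg _) (norm_nonneg _)
    _ = d * ‖v‖ * ‖w‖ := by simp [mul_assoc]

variable {μ : ℝ} {M : Matrix (Fin d) (Fin d) ℝ}

theorem exists_bound_gramian_integrand (h : DominatesSpectrum μ (toC M))
    (Q : Matrix (Fin d) (Fin d) ℝ) (v w : Fin d → ℝ) :
    ∃ K : ℝ, ∀ t : ℝ, 0 ≤ t → |(NormedSpace.exp (t • Mᵀ) *ᵥ v) ⬝ᵥ
        (Q *ᵥ (NormedSpace.exp (t • Mᵀ) *ᵥ w))| ≤ K * Real.exp (2 * μ * t) := by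
  obtain ⟨K, hK0, hK⟩ := h.exists_bound
  set L := Q.mulVecLin.toContinuousLinearMap
  refine ⟨d * K * K * ‖L‖ * ‖v‖ * ‖w‖, fun t ht => ?_⟩
  have h1 := (hK t ht v).2
  have h2 : ‖Q *ᵥ (NormedSpace.exp (t • Mᵀ) *ᵥ w)‖ ≤ ‖L‖ * (K * Real.exp (μ * t) * ‖w‖) :=
    (L.le_opNorm _).trans (by gcongr; exact (hK t ht w).2)
  calc _ ≤ d * ‖NormedSpace.exp (t • Mᵀ) *ᵥ v‖ * ‖Q *ᵥ (NormedSpace.exp (t • Mᵀ) *ᵥ w)‖ :=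
        abs_dotProduct_le _ _
    _ ≤ d * (K * Real.exp (μ * t) * ‖v‖) * (‖L‖ * (K * Real.exp (μ * t) * ‖w‖)) := by gcongr
    _ = d * K * K * ‖L‖ * ‖v‖ * ‖w‖ * (Real.exp (μ * t) * Real.exp (μ * t)) := by ring
    _ = _ := by rw [← Real.exp_add]; ring_nf

theorem integrableOn_gramian_integrand (hμ : μ < 0) (h : DominatesSpectrum μ (toC M))
    (Q : Matrix (Fin d) (Fin d) ℝ) (v w : Fin d → ℝ) :
    IntegrableOn (fun s : ℝ => (NormedSpace.exp (s • Mᵀ) *ᵥ v) ⬝ᵥ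
        (Q *ᵥ (NormedSpace.exp (s • Mᵀ) *ᵥ w))) (Ioi 0) := by
  obtain ⟨K, hK⟩ := exists_bound_gramian_integrand h Q v w
  refine integrable_of_isBigO_exp_neg (b := -(2 * μ)) (by linarith) ?_ ?_
  · exact fun t _ => (hasDerivAt_gramian_integrand M Q v w t).continuousAt.continuousWithinAt
  · refine Asymptotics.IsBigO.of_bound K ?_
    filter_upwards [eventually_ge_atTop 0] with t ht
    simpa using hK t ht

theorem gramian_integrand_apply (G : Matrix (Fin d) (Fin m) ℝ) (s : ℝ) (i j : Fin d) :
    (NormedSpace.exp (s • M) * G * Gᵀ * NormedSpace.exp (s • Mᵀ)) i j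
      = (NormedSpace.exp (s • Mᵀ) *ᵥ Pi.single i 1) ⬝ᵥ
        ((G * Gᵀ) *ᵥ (NormedSpace.exp (s • Mᵀ) *ᵥ Pi.single j 1)) := by
  rw [exp_smul_transpose, transpose_mulVec_dotProduct, mulVec_mulVec, mulVec_mulVec,
    single_one_dotProduct, mulVec_single_one, ← Matrix.mul_assoc, col_apply]

theorem dotProduct_gramian_mulVec (hμ : μ < 0) (h : DominatesSpectrum μ (toC M))
    (G : Matrix (Fin d) (Fin m) ℝ) (v w : Fin d → ℝ) :
    v ⬝ᵥ (gramian M G *ᵥ w) = ∫ s in Ioi (0 : ℝ), (NormedSpace.exp (s • Mᵀ) *ᵥ v) ⬝ᵥ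
        ((G * Gᵀ) *ᵥ (NormedSpace.exp (s • Mᵀ) *ᵥ w)) := by
  have hpt (s : ℝ) : (NormedSpace.exp (s • Mᵀ) *ᵥ v) ⬝ᵥ
        ((G * Gᵀ) *ᵥ (NormedSpace.exp (s • Mᵀ) *ᵥ w))
      = ∑ i, ∑ j, v i * w j *
        (NormedSpace.exp (s • M) * G * Gᵀ * NormedSpace.exp (s • Mᵀ)) i j := by
    rw [exp_smul_transpose, transpose_mulVec_dotProduct, mulVec_mulVec, mulVec_mulVec,
      ← Matrix.mul_assoc]
    simp only [dotProduct, mulVec, Finset.mul_sum]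
    exact Finset.sum_congr rfl fun i _ => Finset.sum_congr rfl fun j _ => by ring
  have hint (i j : Fin d) : IntegrableOn (fun s : ℝ =>
      (NormedSpace.exp (s • M) * G * Gᵀ * NormedSpace.exp (s • Mᵀ)) i j) (Ioi 0) := by
    simp only [gramian_integrand_apply]
    exact integrableOn_gramian_integrand hμ h _ _ _
  simp only [hpt]
  rw [integral_finsetSum _ fun i _ => integrable_finsetSum _ fun j _ => (hint i j).const_mul _]
  simp only [dotProduct, mulVec, gramian, Finset.mul_sum, of_apply]
  refine Finset.sum_congr rfl fun i _ => ?_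
  rw [integral_finsetSum _ fun j _ => (hint i j).const_mul _]
  exact Finset.sum_congr rfl fun j _ => by rw [integral_const_mul]; ring

/-- The left side is the integral over `[0, ∞)` of the derivative of `e^{sM} G Gᵀ e^{sMᵀ}`, which
decays to `0` and starts at `G Gᵀ`. The computation is done for the associated bilinear form. -/
theorem gramian_lyapunov (hμ : μ < 0) (h : DominatesSpectrum μ (toC M))
    (G : Matrix (Fin d) (Fin m) ℝ) :
    M * gramian M G + gramian M G * Mᵀ = -(G * Gᵀ) := by
  have hform (v w : Fin d → ℝ) : v ⬝ᵥ ((M * gramian M G + gramian M G * Mᵀ) *ᵥ w)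
      = v ⬝ᵥ (-(G * Gᵀ) *ᵥ w) := by
    obtain ⟨K, hK⟩ := exists_bound_gramian_integrand h (G * Gᵀ) v w
    have hlim : Tendsto (fun s : ℝ => (NormedSpace.exp (s • Mᵀ) *ᵥ v) ⬝ᵥ
        ((G * Gᵀ) *ᵥ (NormedSpace.exp (s • Mᵀ) *ᵥ w))) atTop (𝓝 0) := by
      have hexp : Tendsto (fun t : ℝ => K * Real.exp (2 * μ * t)) atTop (𝓝 0) := by
        rw [← mul_zero K]
        refine Tendsto.const_mul K (Real.tendsto_exp_atBot.comp ?_)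
        exact tendsto_id.const_mul_atTop_of_neg (by linarith)
      refine squeeze_zero_norm' ?_ hexp
      filter_upwards [eventually_ge_atTop 0] with t ht using hK t ht
    have hI := integrableOn_gramian_integrand hμ h (G * Gᵀ)
    have hftc := integral_Ioi_of_hasDerivAt_of_tendsto'
      (fun t _ => hasDerivAt_gramian_integrand M (G * Gᵀ) v w t)
      ((hI (Mᵀ *ᵥ v) w).add (hI v (Mᵀ *ᵥ w))) hlim
    rw [integral_add (hI (Mᵀ *ᵥ v) w) (hI v (Mᵀ *ᵥ w)), ← dotProduct_gramian_mulVec hμ h,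
      ← dotProduct_gramian_mulVec hμ h, transpose_mulVec_dotProduct] at hftc
    simp only [zero_smul, NormedSpace.exp_zero, one_mulVec, zero_sub] at hftc
    rw [add_mulVec, dotProduct_add, ← mulVec_mulVec, ← mulVec_mulVec, hftc, neg_mulVec,
      dotProduct_neg]
  ext i j
  simpa [single_one_dotProduct, mulVec_single_one] using hform (Pi.single i 1) (Pi.single j 1)

end Gramian

/-! ### Impulse-free and stable semi-explicit pairs -/

section Pencil

/-- The kernel of `[E 0; M E]` contains all `(0, z)` with `E z = 0`, and the rank condition says
that it contains nothing else. A null vector `v` of `M₂₂` would add the element with first half `(0,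
v)` and second half `(-M₁₂ v, 0)`. -/
theorem IsImpulseFree.isUnit_det_toBlocks₂₂ {d q : ℕ}
    {M : Matrix (Fin d ⊕ Fin q) (Fin d ⊕ Fin q) ℝ}
    (h : IsImpulseFree (fromBlocks 1 0 0 0) M) : IsUnit M.toBlocks₂₂.det := by
  set E : Matrix (Fin d ⊕ Fin q) (Fin d ⊕ Fin q) ℝ := fromBlocks 1 0 0 0 with hE
  set ψ : (Fin d ⊕ Fin q → ℝ) →ₗ[ℝ] ((Fin d ⊕ Fin q) ⊕ (Fin d ⊕ Fin q) → ℝ) :=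
    { toFun := fun z => Sum.elim 0 z
      map_add' := fun a b => by ext (i | i) <;> simp
      map_smul' := fun c a => by ext (i | i) <;> simp } with hψ
  have hψinj : Function.Injective ψ := fun a b hab => by
    funext i
    simpa [hψ] using congrFun hab (Sum.inr i)
  set kE := LinearMap.ker E.mulVecLin
  set kB := LinearMap.ker (fromBlocks E 0 M E).mulVecLin with hkB
  have hle : kE.map ψ ≤ kB := by
    rintro _ ⟨z, hz, rfl⟩
    have hz' : E *ᵥ z = 0 := hz
    rw [hkB, LinearMap.mem_ker, mulVecLin_apply, hψ]
    simp [fromBlocks_mulVec, hz']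
  have hdim : Module.finrank ℝ (kE.map ψ) = Module.finrank ℝ kB := by
    rw [← (Submodule.equivMapOfInjective ψ hψinj kE).finrank_eq]
    have h1 := LinearMap.finrank_range_add_finrank_ker E.mulVecLin
    have h2 := LinearMap.finrank_range_add_finrank_ker (fromBlocks E 0 M E).mulVecLin
    rw [IsImpulseFree, Matrix.rank, Matrix.rank] at h
    rw [h] at h2
    rw [Module.finrank_fintype_fun_eq_card] at h1 h2
    rw [Fintype.card_sum (α := Fin d ⊕ Fin q) (β := Fin d ⊕ Fin q)] at h2
    simp only [kE, kB]
    omega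
  have heq := Submodule.eq_of_le_of_finrank_eq hle hdim
  by_contra hdet
  rw [isUnit_iff_ne_zero, not_not] at hdet
  obtain ⟨v, hv0, hv⟩ := exists_mulVec_eq_zero_iff.2 hdet
  have hmem : Sum.elim (Sum.elim (0 : Fin d → ℝ) v) (Sum.elim (-(M.toBlocks₁₂ *ᵥ v)) (0 : Fin q → ℝ)) ∈ kB := by
    rw [hkB, LinearMap.mem_ker, mulVecLin_apply, fromBlocks_mulVec, ← fromBlocks_toBlocks M, hE]
    ext ((i | i) | (i | i)) <;> simp [fromBlocks_mulVec, hv]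
  rw [← heq] at hmem
  obtain ⟨z, -, hz⟩ := hmem
  refine hv0 (funext fun i => ?_)
  simpa [hψ] using (congrFun hz (Sum.inl (Sum.inr i))).symm

theorem mem_spectrum_iff_exists_mulVec {ι : Type*} [Fintype ι] [DecidableEq ι]
    {M : Matrix ι ι ℂ} {z : ℂ} : z ∈ spectrum ℂ M ↔ ∃ v : ι → ℂ, v ≠ 0 ∧ M *ᵥ v = z • v := by
  rw [spectrum.mem_iff, isUnit_iff_isUnit_det, isUnit_iff_ne_zero, not_not,
    ← exists_mulVec_eq_zero_iff, Algebra.algebraMap_eq_smul_one]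
  simp only [sub_mulVec, smul_mulVec, one_mulVec, sub_eq_zero]
  exact exists_congr fun v => and_congr_right fun _ => eq_comm

theorem toC_mul {α β γ : Type*} [Fintype β] (M : Matrix α β ℝ) (N : Matrix β γ ℝ) :
    toC (M * N) = toC M * toC N :=
  Matrix.map_mul

theorem toC_one {ι : Type*} [DecidableEq ι] : toC (1 : Matrix ι ι ℝ) = 1 :=
  Matrix.map_one _ (map_zero _) (map_one _)

theorem toC_sub {α β : Type*} (M N : Matrix α β ℝ) : toC (M - N) = toC M - toC N :=
  Matrix.map_sub _ (map_sub _) M N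

/-- In Weierstrass coordinates the fast part satisfies `y₂ = z N y₂`; iterating, it vanishes since
`N` is nilpotent. The slow part is then a nonzero eigenvector of `J`. -/
theorem IsWeierstrassForm.mem_spectrum {ι : Type*} [Fintype ι] [DecidableEq ι]
    {E A : Matrix ι ι ℝ} {r p : ℕ} {J : Matrix (Fin r) (Fin r) ℂ} {N : Matrix (Fin p) (Fin p) ℂ}
    (h : IsWeierstrassForm E A J N) {z : ℂ} {w : ι → ℂ} (hw : w ≠ 0)
    (hz : toC A *ᵥ w = z • (toC E *ᵥ w)) : z ∈ spectrum ℂ J := by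
  obtain ⟨⟨k, hN⟩, T, T', V, V', -, -, hVV', -, hE, hA⟩ := h
  set y := V' *ᵥ w with hy
  have hVy : V *ᵥ y = w := by rw [hy, mulVec_mulVec, hVV', one_mulVec]
  have hy0 : y ≠ 0 := fun h0 => hw (by rw [← hVy, h0, mulVec_zero])
  have hyz : fromBlocks J 0 0 1 *ᵥ y = z • (fromBlocks 1 0 0 N *ᵥ y) := by
    rw [← hE, ← hA]
    simp only [← mulVec_mulVec, hVy, hz, mulVec_smul]
  rw [fromBlocks_mulVec, fromBlocks_mulVec] at hyz
  have h1 : J *ᵥ (y ∘ Sum.inl) = z • (y ∘ Sum.inl) := by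
    funext i
    simpa using congrFun hyz (Sum.inl i)
  have h2 : y ∘ Sum.inr = z • (N *ᵥ (y ∘ Sum.inr)) := by
    funext i
    simpa using congrFun hyz (Sum.inr i)
  have hpow (j : ℕ) : y ∘ Sum.inr = z ^ j • (N ^ j *ᵥ (y ∘ Sum.inr)) := by
    induction j with
    | zero => simp
    | succ j ih =>
      conv_lhs => rw [ih, h2]
      rw [mulVec_smul, mulVec_mulVec, smul_smul, ← pow_succ, ← pow_succ]
  have h2' : y ∘ Sum.inr = 0 := by rw [hpow k, hN, zero_mulVec, smul_zero]
  refine mem_spectrum_iff_exists_mulVec.2 ⟨y ∘ Sum.inl, fun h1' => hy0 ?_, h1⟩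
  funext i
  rcases i with i | i
  · exact congrFun h1' i
  · exact congrFun h2' i

/-- An eigenvector `v` of the Schur complement extends to the eigenvector `(v, -M₂₂⁻¹ M₂₁ v)` of the
pencil, with the same eigenvalue. -/
theorem IsFiniteDynamicsStable.re_lt_zero {d q : ℕ}
    {M : Matrix (Fin d ⊕ Fin q) (Fin d ⊕ Fin q) ℝ}
    (h : IsFiniteDynamicsStable (fromBlocks 1 0 0 0) M) (hdet : IsUnit M.toBlocks₂₂.det) {z : ℂ}
    (hz : z ∈ spectrum ℂ (toC (Abar M))) : z.re < 0 := by
  obtain ⟨r, p, J, N, hW, hJ⟩ := h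
  obtain ⟨v, hv0, hv⟩ := mem_spectrum_iff_exists_mulVec.1 hz
  have hinv : toC M.toBlocks₂₂ * toC M.toBlocks₂₂⁻¹ = 1 := by
    rw [← toC_mul, mul_nonsing_inv _ hdet, toC_one]
  set y : Fin q → ℂ := -(toC M.toBlocks₂₂⁻¹ *ᵥ (toC M.toBlocks₂₁ *ᵥ v)) with hy
  have htoE : toC (fromBlocks 1 0 0 0 : Matrix (Fin d ⊕ Fin q) (Fin d ⊕ Fin q) ℝ)
      = fromBlocks 1 0 0 0 := by
    rw [toC, fromBlocks_map, Matrix.map_one _ (map_zero _) (map_one _)]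
    simp
  have htoM : toC M = fromBlocks (toC M.toBlocks₁₁) (toC M.toBlocks₁₂) (toC M.toBlocks₂₁)
      (toC M.toBlocks₂₂) := by
    conv_lhs => rw [← fromBlocks_toBlocks M]
    exact fromBlocks_map ..
  have hEw : toC (fromBlocks 1 0 0 0 : Matrix (Fin d ⊕ Fin q) (Fin d ⊕ Fin q) ℝ) *ᵥ Sum.elim v y
      = Sum.elim v 0 := by
    rw [htoE, fromBlocks_mulVec]
    simp
  have hMw : toC M *ᵥ Sum.elim v y = Sum.elim (z • v) 0 := by
    rw [htoM, fromBlocks_mulVec, Sum.elim_comp_inl, Sum.elim_comp_inr, ← hv, Abar, toC_sub,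
      toC_mul, toC_mul, hy, mulVec_neg, mulVec_neg, mulVec_mulVec _ (toC M.toBlocks₂₂), hinv,
      one_mulVec, add_neg_cancel, sub_mulVec, ← mulVec_mulVec, ← mulVec_mulVec, ← sub_eq_add_neg]
  refine hJ z (hW.mem_spectrum (w := Sum.elim v y) (fun h0 => hv0 ?_) ?_)
  · funext i
    simpa using congrFun h0 (Sum.inl i)
  · rw [hEw, hMw]
    funext i
    rcases i with i | i <;> simp

end Pencil

/-! ### Spectral abscissa and admissible decay rates -/

section Abscissa

variable {ι : Type*} [Fintype ι] [DecidableEq ι] {M : Matrix ι ι ℝ} {μ : ℝ}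

/-- The strict inequality survives the supremum because the spectrum is finite; an empty spectrum
gives `⊥ < 0`. -/
theorem spectralAbscissa_lt_zero (h : ∀ z ∈ spectrum ℂ (toC M), z.re < 0) :
    spectralAbscissa M < 0 := by
  have hfin : (spectrum ℂ (toC M)).Finite := Matrix.finite_spectrum _
  have hsup : spectralAbscissa M = hfin.toFinset.sup fun z => ((z.re : ℝ) : EReal) := by
    rw [Finset.sup_eq_iSup, spectralAbscissa]
    simp only [Set.Finite.mem_toFinset]
  rw [hsup, Finset.sup_lt_iff EReal.bot_lt_zero]
  intro z hz
  exact EReal.coe_neg'.2 (h z (hfin.mem_toFinset.1 hz))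

theorem re_le_spectralAbscissa {z : ℂ} (hz : z ∈ spectrum ℂ (toC M)) :
    ((z.re : ℝ) : EReal) ≤ spectralAbscissa M :=
  le_iSup₂ (f := fun z (_ : z ∈ spectrum ℂ (toC M)) => ((z.re : ℝ) : EReal)) z hz

theorem dominatesSpectrum_of_spectralAbscissa_lt (h : spectralAbscissa M < (μ : EReal)) :
    DominatesSpectrum μ (toC M) := fun _ hz =>
  Or.inl (EReal.coe_lt_coe_iff.1 ((re_le_spectralAbscissa hz).trans_lt h))

theorem dominatesSpectrum_of_spectralAbscissa_eq (h : spectralAbscissa M = (μ : EReal))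
    (hss : DominantSemisimple M) : DominatesSpectrum μ (toC M) := fun z hz => by
  rcases (re_le_spectralAbscissa hz).lt_or_eq with hlt | heq
  · exact Or.inl (EReal.coe_lt_coe_iff.1 (hlt.trans_eq h))
  · exact Or.inr ⟨EReal.coe_eq_coe_iff.1 (heq.trans h), hss z hz heq⟩

theorem isUnit_det_of_re_lt_zero (h : ∀ z ∈ spectrum ℂ (toC M), z.re < 0) : IsUnit M.det := by
  rw [isUnit_iff_ne_zero]
  intro hdet
  obtain ⟨v, hv0, hv⟩ := exists_mulVec_eq_zero_iff.2 hdet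
  refine lt_irrefl (0 : ℝ) (h 0 (mem_spectrum_iff_exists_mulVec.2
    ⟨fun i => (v i : ℂ), fun h0 => hv0 (funext fun i => by simpa using congrFun h0 i), ?_⟩))
  rw [toC_mulVec, hv, zero_smul]
  funext i
  simp

end Abscissa

/-! ### Reduction of a semi-explicit extremal to its differential part -/

section Reduction

variable {d q m k l : ℕ}

/-- The state of the closed loop system with differential part `x₁` and input `v`. -/
noncomputable def fullState (Ap : Matrix (Fin d ⊕ Fin q) (Fin d ⊕ Fin q) ℝ)
    (B : Matrix (Fin d ⊕ Fin q) (Fin m) ℝ) (x₁ : Fin d → ℝ) (v : Fin m → ℝ) : Fin d ⊕ Fin q → ℝ :=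
  Sum.elim x₁ (-(Ap.toBlocks₂₂⁻¹ *ᵥ (Ap.toBlocks₂₁ *ᵥ x₁ + inputBot B *ᵥ v)))

/-- The solution of the adjoint closed loop system with differential part `p`. -/
noncomputable def fullCostate (Ap : Matrix (Fin d ⊕ Fin q) (Fin d ⊕ Fin q) ℝ)
    (C : Matrix (Fin k) (Fin d ⊕ Fin q) ℝ) (yc : Fin k → ℝ) (p : Fin d → ℝ) : Fin d ⊕ Fin q → ℝ :=
  Sum.elim p (Ap.toBlocks₂₂⁻¹ᵀ *ᵥ ((outputRight C)ᵀ *ᵥ yc - Ap.toBlocks₁₂ᵀ *ᵥ p))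

theorem eq_fromBlocks_inputs (B : Matrix (Fin d ⊕ Fin q) (Fin m) ℝ) (v : Fin m → ℝ) :
    B *ᵥ v = Sum.elim (inputTop B *ᵥ v) (inputBot B *ᵥ v) := by
  funext i
  rcases i with i | i <;> rfl

theorem transpose_output_mulVec (C : Matrix (Fin k) (Fin d ⊕ Fin q) ℝ) (y : Fin k → ℝ) :
    Cᵀ *ᵥ y = Sum.elim ((outputLeft C)ᵀ *ᵥ y) ((outputRight C)ᵀ *ᵥ y) := by
  funext i
  rcases i with i | i <;> rfl

theorem transpose_input_mulVec_sumElim (B : Matrix (Fin d ⊕ Fin q) (Fin m) ℝ) (a : Fin d → ℝ)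
    (b : Fin q → ℝ) : Bᵀ *ᵥ Sum.elim a b = (inputTop B)ᵀ *ᵥ a + (inputBot B)ᵀ *ᵥ b := by
  funext i
  simp [mulVec, dotProduct, Fintype.sum_sum_type, inputTop, inputBot]

theorem mulVec_sumElim (M : Matrix (Fin d ⊕ Fin q) (Fin d ⊕ Fin q) ℝ)
    (a : Fin d → ℝ) (b : Fin q → ℝ) :
    M *ᵥ Sum.elim a b = Sum.elim (M.toBlocks₁₁ *ᵥ a + M.toBlocks₁₂ *ᵥ b)
      (M.toBlocks₂₁ *ᵥ a + M.toBlocks₂₂ *ᵥ b) := by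
  conv_lhs => rw [← fromBlocks_toBlocks M]
  rw [fromBlocks_mulVec, Sum.elim_comp_inl, Sum.elim_comp_inr]

theorem transpose_mulVec_sumElim (M : Matrix (Fin d ⊕ Fin q) (Fin d ⊕ Fin q) ℝ)
    (a : Fin d → ℝ) (b : Fin q → ℝ) :
    Mᵀ *ᵥ Sum.elim a b = Sum.elim (M.toBlocks₁₁ᵀ *ᵥ a + M.toBlocks₂₁ᵀ *ᵥ b)
      (M.toBlocks₁₂ᵀ *ᵥ a + M.toBlocks₂₂ᵀ *ᵥ b) := by
  conv_lhs => rw [← fromBlocks_toBlocks M, fromBlocks_transpose]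
  rw [fromBlocks_mulVec, Sum.elim_comp_inl, Sum.elim_comp_inr]

theorem projection_mulVec_sumElim (a : Fin d → ℝ) (b : Fin q → ℝ) :
    (fromBlocks 1 0 0 0 : Matrix (Fin d ⊕ Fin q) (Fin d ⊕ Fin q) ℝ) *ᵥ Sum.elim a b
      = Sum.elim a 0 := by
  rw [fromBlocks_mulVec]
  simp

theorem sumElim_add_sumElim (a a' : Fin d → ℝ) (b b' : Fin q → ℝ) :
    Sum.elim a b + Sum.elim a' b' = Sum.elim (a + a') (b + b') := by
  funext i
  rcases i with i | i <;> rfl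

theorem sumElim_sub_sumElim (a a' : Fin d → ℝ) (b b' : Fin q → ℝ) :
    Sum.elim a b - Sum.elim a' b' = Sum.elim (a - a') (b - b') := by
  funext i
  rcases i with i | i <;> rfl

variable {A P Ap : Matrix (Fin d ⊕ Fin q) (Fin d ⊕ Fin q) ℝ}
  {B : Matrix (Fin d ⊕ Fin q) (Fin m) ℝ} {C : Matrix (Fin k) (Fin d ⊕ Fin q) ℝ}
  {F : Matrix (Fin l) (Fin d ⊕ Fin q) ℝ}
  {x₀ : Fin d ⊕ Fin q → ℝ} {yc : Fin k → ℝ} {ye : Fin l → ℝ}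

/-- The algebraic part of `fullState` solves the second block row; substituting it into the first
produces the Schur complement coefficients. -/
theorem mulVec_fullState (hdet : IsUnit Ap.toBlocks₂₂.det) (x₁ : Fin d → ℝ) (v : Fin m → ℝ) :
    Ap *ᵥ fullState Ap B x₁ v + B *ᵥ v = Sum.elim (Abar Ap *ᵥ x₁ + Bbar Ap B *ᵥ v) 0 := by
  rw [fullState, mulVec_sumElim, eq_fromBlocks_inputs, sumElim_add_sumElim]
  congr 1
  · simp only [Abar, Bbar, sub_mulVec, mulVec_neg, mulVec_add, ← mulVec_mulVec]
    abel
  · rw [mulVec_neg, mulVec_mulVec, mul_nonsing_inv _ hdet, one_mulVec]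
    abel

theorem transpose_mulVec_fullCostate (hdet : IsUnit Ap.toBlocks₂₂.det) (p : Fin d → ℝ) :
    Apᵀ *ᵥ fullCostate Ap C yc p
      = Cᵀ *ᵥ yc - Sum.elim ((Cbar Ap C)ᵀ *ᵥ yc - (Abar Ap)ᵀ *ᵥ p) 0 := by
  rw [fullCostate, transpose_mulVec_sumElim, transpose_output_mulVec, sumElim_sub_sumElim]
  congr 1
  · simp only [Abar, Cbar, transpose_sub, transpose_mul, sub_mulVec, mulVec_sub, ← mulVec_mulVec]
    abel
  · rw [mulVec_mulVec, ← transpose_mul, nonsing_inv_mul _ hdet, transpose_one, one_mulVec]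
    abel

theorem transpose_input_mulVec_fullCostate (p : Fin d → ℝ) :
    Bᵀ *ᵥ fullCostate Ap C yc p = (Bbar Ap B)ᵀ *ᵥ p
      + ((inputBot B)ᵀ * Ap.toBlocks₂₂⁻¹ᵀ * (outputRight C)ᵀ) *ᵥ yc := by
  rw [fullCostate, transpose_input_mulVec_sumElim]
  simp only [Bbar, transpose_sub, transpose_mul, sub_mulVec, mulVec_sub, ← mulVec_mulVec]
  abel

theorem hasDerivAt_sumElim {f : ℝ → Fin d → ℝ} {g : ℝ → Fin q → ℝ} {f' : Fin d → ℝ}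
    {g' : Fin q → ℝ} {t : ℝ} (hf : HasDerivAt f f' t) (hg : HasDerivAt g g' t) :
    HasDerivAt (fun s => Sum.elim (f s) (g s)) (Sum.elim f' g') t := by
  rw [hasDerivAt_pi] at hf hg ⊢
  rintro (i | i)
  · exact hf i
  · exact hg i

theorem hasDerivAt_fullState {x₁ : ℝ → Fin d → ℝ} {v : ℝ → Fin m → ℝ} {x₁' : Fin d → ℝ}
    {v' : Fin m → ℝ} {t : ℝ} (hx : HasDerivAt x₁ x₁' t) (hv : HasDerivAt v v' t) :
    HasDerivAt (fun s => fullState Ap B (x₁ s) (v s)) (fullState Ap B x₁' v') t :=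
  hasDerivAt_sumElim hx
    (hasDerivAt_mulVec _ ((hasDerivAt_mulVec _ hx).add (hasDerivAt_mulVec _ hv))).neg

theorem hasDerivAt_fullCostate {p : ℝ → Fin d → ℝ} {p' : Fin d → ℝ} {t : ℝ}
    (hp : HasDerivAt p p' t) :
    HasDerivAt (fun s => fullCostate Ap C yc (p s)) (fullCostate Ap C 0 p') t := by
  have h := hasDerivAt_sumElim hp (hasDerivAt_mulVec Ap.toBlocks₂₂⁻¹ᵀ
    ((hasDerivAt_mulVec Ap.toBlocks₁₂ᵀ hp).const_sub ((outputRight C)ᵀ *ᵥ yc)))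
  rw [fullCostate, mulVec_zero, zero_sub]
  exact h

theorem continuous_sumElim {f : ℝ → Fin d → ℝ} {g : ℝ → Fin q → ℝ} (hf : Continuous f)
    (hg : Continuous g) : Continuous fun s => Sum.elim (f s) (g s) := by
  rw [continuous_pi_iff] at hf hg ⊢
  rintro (i | i)
  · exact hf i
  · exact hg i

theorem continuous_mulVec {ι κ : Type*} [Fintype ι] (M : Matrix κ ι ℝ) {f : ℝ → ι → ℝ}
    (hf : Continuous f) : Continuous fun s => M *ᵥ f s :=
  Continuous.matrix_mulVec continuous_const hf

theorem continuous_fullState {x₁ : ℝ → Fin d → ℝ} {v : ℝ → Fin m → ℝ} (hx : Continuous x₁)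
    (hv : Continuous v) : Continuous fun s => fullState Ap B (x₁ s) (v s) :=
  continuous_sumElim hx
    (continuous_mulVec _ ((continuous_mulVec _ hx).add (continuous_mulVec _ hv))).neg

theorem continuous_fullCostate {p : ℝ → Fin d → ℝ} (hp : Continuous p) :
    Continuous fun s => fullCostate Ap C yc (p s) :=
  continuous_sumElim hp (continuous_mulVec _ (continuous_const.sub (continuous_mulVec _ hp)))

theorem transpose_projection :
    (fromBlocks 1 0 0 0 : Matrix (Fin d ⊕ Fin q) (Fin d ⊕ Fin q) ℝ)ᵀ = fromBlocks 1 0 0 0 := by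
  rw [fromBlocks_transpose]
  simp

/-- `Eᵀ` is a projection, hence the identity on its range, which contains that of `Fᵀ`. So the
terminal cost sees only the differential variables. -/
theorem mul_projection_eq_self {E : Matrix (Fin d ⊕ Fin q) (Fin d ⊕ Fin q) ℝ}
    (hE : E = fromBlocks 1 0 0 0)
    (hF : LinearMap.range (Matrix.mulVecLin Fᵀ) ≤ LinearMap.range (Matrix.mulVecLin Eᵀ)) :
    F * E = F := by
  have hEE : Eᵀ * Eᵀ = Eᵀ := by
    rw [hE, transpose_projection, fromBlocks_multiply]
    simp
  have h : Eᵀ * Fᵀ = Fᵀ := by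
    refine ext_of_mulVec_single fun j => ?_
    obtain ⟨w, hw⟩ := hF (LinearMap.mem_range_self (Matrix.mulVecLin Fᵀ) (Pi.single j 1))
    simp only [mulVecLin_apply] at hw
    rw [← mulVec_mulVec, ← hw, mulVec_mulVec, hEE]
  simpa using congrArg transpose h

theorem transpose_mulVec_eq_of_mul_projection (hF : F * (fromBlocks 1 0 0 0 : Matrix (Fin d ⊕ Fin q) (Fin d ⊕ Fin q) ℝ) = F) (y : Fin l → ℝ) :
    Fᵀ *ᵥ y = Sum.elim (fun i => (Fᵀ *ᵥ y) (Sum.inl i)) 0 := by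
  have h := congrArg transpose hF
  rw [transpose_mul, transpose_projection] at h
  conv_lhs => rw [← h, ← mulVec_mulVec, ← Sum.elim_comp_inl_inr (Fᵀ *ᵥ y),
    projection_mulVec_sumElim]
  rfl

theorem gram_mulVec_of_mul_projection (hF : F * (fromBlocks 1 0 0 0 : Matrix (Fin d ⊕ Fin q) (Fin d ⊕ Fin q) ℝ) = F) (a : Fin d → ℝ)
    (b : Fin q → ℝ) :
    Fᵀ *ᵥ (F *ᵥ Sum.elim a b) = Sum.elim ((Fᵀ * F).toBlocks₁₁ *ᵥ a) 0 := by
  have h : F *ᵥ Sum.elim a b = F *ᵥ Sum.elim a 0 := by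
    conv_lhs => rw [← hF, ← mulVec_mulVec, projection_mulVec_sumElim]
  rw [h, transpose_mulVec_eq_of_mul_projection hF, mulVec_mulVec, mulVec_sumElim]
  simp only [mulVec_zero, add_zero, Sum.elim_inl]

/-- Solutions of the reduced boundary value problem induce extremals. -/
theorem isExtremal_of_reduced {E : Matrix (Fin d ⊕ Fin q) (Fin d ⊕ Fin q) ℝ}
    (hE : E = fromBlocks 1 0 0 0) (hP : IsStabilizingSolution E A B C P)
    (hAp : Ap = closedLoop A B P) (hdet : IsUnit Ap.toBlocks₂₂.det) (hF : F * (fromBlocks 1 0 0 0 : Matrix (Fin d ⊕ Fin q) (Fin d ⊕ Fin q) ℝ) = F) {T : ℝ}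
    {x₁ x₁' p p' : ℝ → Fin d → ℝ} {v : ℝ → Fin m → ℝ}
    (hv : ∀ t, v t = -(Bᵀ *ᵥ fullCostate Ap C yc (p t)))
    (hx : ∀ t, HasDerivAt x₁ (x₁' t) t) (hp : ∀ t, HasDerivAt p (p' t) t)
    (hx' : ∀ t, x₁' t = Abar Ap *ᵥ x₁ t + Bbar Ap B *ᵥ v t)
    (hp' : ∀ t, p' t = (Cbar Ap C)ᵀ *ᵥ yc - (Abar Ap)ᵀ *ᵥ p t)
    (hx0 : x₁ 0 = x₀ ∘ Sum.inl)
    (hpT : p T = ((Fᵀ * F).toBlocks₁₁ - P.toBlocks₁₁) *ᵥ x₁ T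
      - fun i => (Fᵀ *ᵥ ye) (Sum.inl i)) :
    ∃ x' l' : ℝ → Fin d ⊕ Fin q → ℝ, IsExtremal E A B C F x₀ yc ye T
      (fun t => fullState Ap B (x₁ t) (v t)) x'
      (fun t => -((Bᵀ * P) *ᵥ fullState Ap B (x₁ t) (v t)) + v t)
      (fun t => P *ᵥ fullState Ap B (x₁ t) (v t)
        + fullCostate Ap C yc (p t)) l' := by
  subst hAp
  set M := closedLoop A B P with hM
  have hpc : Continuous p := continuous_iff_continuousAt.2 fun t => (hp t).continuousAt
  have hxc : Continuous x₁ := continuous_iff_continuousAt.2 fun t => (hx t).continuousAt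
  have hvc : Continuous v := by
    rw [funext hv]; exact (continuous_mulVec _ (continuous_fullCostate hpc)).neg
  have hp'c : Continuous p' := by
    rw [funext hp']; exact continuous_const.sub (continuous_mulVec _ hpc)
  have hx'c : Continuous x₁' := by
    rw [funext hx']; exact (continuous_mulVec _ hxc).add (continuous_mulVec _ hvc)
  -- The algebraic state depends on `v`, so `v` must be differentiated too. `fullCostate` is affine
  -- in `p`, and its constant term drops out on setting `yc` to `0`.
  set v' : ℝ → Fin m → ℝ := fun t => -(Bᵀ *ᵥ fullCostate M C 0 (p' t)) with hv'
  have hvd (t : ℝ) : HasDerivAt v (v' t) t := by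
    rw [funext hv]; exact (hasDerivAt_mulVec _ (hasDerivAt_fullCostate (hp t))).neg
  have hv'c : Continuous v' := (continuous_mulVec _ (continuous_fullCostate hp'c)).neg
  have hMx (z : Fin d ⊕ Fin q → ℝ) (w : Fin m → ℝ) :
      A *ᵥ z + B *ᵥ (-((Bᵀ * P) *ᵥ z) + w) = M *ᵥ z + B *ᵥ w := by
    rw [hM, closedLoop, mulVec_add, mulVec_neg, sub_mulVec, mulVec_mulVec, Matrix.mul_assoc]
    abel
  have hdae (t : ℝ) : E *ᵥ fullState M B (x₁' t) (v' t) = A *ᵥ fullState M B (x₁ t) (v t)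
      + B *ᵥ (-((Bᵀ * P) *ᵥ fullState M B (x₁ t) (v t)) + v t) := by
    rw [hMx, mulVec_fullState hdet, hE, fullState, projection_mulVec_sumElim, hx']
  refine ⟨fun t => fullState M B (x₁' t) (v' t),
    fun t => P *ᵥ fullState M B (x₁' t) (v' t) + fullCostate M C 0 (p' t), ?_⟩
  refine
    { state_deriv := fun t => hasDerivAt_fullState (hx t) (hvd t)
      control_cont := (continuous_mulVec _ (continuous_fullState hxc hvc)).neg.add hvc
      costate_deriv := fun t => (hasDerivAt_mulVec P (hasDerivAt_fullState (hx t) (hvd t))).add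
        (hasDerivAt_fullCostate (hp t))
      costate_deriv_cont := (continuous_mulVec P (continuous_fullState hx'c hv'c)).add
        (continuous_fullCostate hp'c)
      dae := hdae
      init := ?_
      adjoint := fun t => ?_
      control := fun t => ?_
      transversality := ?_ }
  · rw [hE, fullState, projection_mulVec_sumElim, hx0]
    conv_rhs => rw [← Sum.elim_comp_inl_inr x₀, projection_mulVec_sumElim]
  · have hd := hdae t
    set z := fullState M B (x₁ t) (v t)
    clear_value z
    set π := fullCostate M C yc (p t) with hπ
    have h1 : Eᵀ *ᵥ fullCostate M C 0 (p' t) = Cᵀ *ᵥ yc - Mᵀ *ᵥ π := by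
      rw [hπ, transpose_mulVec_fullCostate hdet, hE, transpose_projection, fullCostate,
        projection_mulVec_sumElim, hp']
      abel
    have h2 : Mᵀ *ᵥ π = Aᵀ *ᵥ π - (Pᵀ * B * Bᵀ) *ᵥ π := by
      rw [hM, closedLoop, transpose_sub, transpose_mul, transpose_mul, transpose_transpose,
        sub_mulVec, Matrix.mul_assoc]
    -- With `Eᵀ P = Pᵀ E`, the term `Eᵀ P z'` equals `Pᵀ E z'` and the state equation applies; the
    -- Riccati equation then cancels what is linear in `z`.
    have h3 := congrArg (· *ᵥ z) hP.riccati
    simp only [add_mulVec, sub_mulVec, zero_mulVec, ← mulVec_mulVec] at h3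
    rw [mulVec_add, h1, h2, mulVec_mulVec _ Eᵀ, hP.symm, ← mulVec_mulVec, hd, hv t, ← hπ]
    simp only [mulVec_add, mulVec_sub, mulVec_neg, ← mulVec_mulVec] at h3 ⊢
    linear_combination (exp := 1) h3
  · rw [mulVec_add, hv t, mulVec_mulVec]
    abel
  · have hP12 := congrArg toBlocks₁₂ hP.symm
    -- The symmetry `Eᵀ P = Pᵀ E` kills this block, so the terminal condition involves only `x₁` and
    -- `p`.
    have hP11 : P.toBlocks₁₂ = 0 := by
      rw [hE, transpose_projection, ← fromBlocks_toBlocks P, fromBlocks_transpose,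
        fromBlocks_multiply, fromBlocks_multiply] at hP12
      simpa using hP12
    rw [mulVec_add, mulVec_sub, transpose_mulVec_eq_of_mul_projection hF ye]
    simp only [fullState, fullCostate]
    rw [gram_mulVec_of_mul_projection hF, mulVec_sumElim P, hE, transpose_projection,
      projection_mulVec_sumElim, projection_mulVec_sumElim, hP11, zero_mulVec, add_zero, hpT,
      sumElim_add_sumElim, sumElim_sub_sumElim, sub_mulVec]
    congr 1
    · abel
    · simp

end Reduction

/-! ### Uniform solvability of the boundary condition -/

section Boundary

variable {d : ℕ}

/-- The Gramian on `[0, t]`, expressed by the infinite horizon Gramian `X` of `M`. -/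
noncomputable def finiteGramian (M X : Matrix (Fin d) (Fin d) ℝ) (t : ℝ) :
    Matrix (Fin d) (Fin d) ℝ :=
  X - NormedSpace.exp (t • M) * X * NormedSpace.exp (t • Mᵀ)

theorem finiteGramian_zero (M X : Matrix (Fin d) (Fin d) ℝ) : finiteGramian M X 0 = 0 := by
  simp [finiteGramian]

open scoped Matrix.Norms.Operator in
theorem continuous_exp_smul (M : Matrix (Fin d) (Fin d) ℝ) :
    Continuous fun t : ℝ => NormedSpace.exp (t • M) :=
  NormedSpace.exp_continuous.comp (continuous_id.smul continuous_const)

theorem continuous_finiteGramian (M X : Matrix (Fin d) (Fin d) ℝ) :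
    Continuous (finiteGramian M X) :=
  continuous_const.sub (((continuous_exp_smul M).matrix_mul continuous_const).matrix_mul
    (continuous_exp_smul Mᵀ))

variable {μ : ℝ} {M : Matrix (Fin d) (Fin d) ℝ}

theorem tendsto_const_mul_exp (hμ : μ < 0) (K : ℝ) :
    Tendsto (fun t : ℝ => K * Real.exp (μ * t)) atTop (𝓝 0) := by
  rw [← mul_zero K]
  exact (Real.tendsto_exp_atBot.comp (tendsto_id.const_mul_atTop_of_neg hμ)).const_mul K

theorem DominatesSpectrum.tendsto_exp_smul (hμ : μ < 0) (h : DominatesSpectrum μ (toC M)) :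
    Tendsto (fun t : ℝ => NormedSpace.exp (t • M)) atTop (𝓝 0) := by
  obtain ⟨K, -, hK⟩ := h.exists_bound_entry
  refine tendsto_pi_nhds.2 fun i => tendsto_pi_nhds.2 fun j => ?_
  refine squeeze_zero_norm' ?_ (tendsto_const_mul_exp hμ K)
  filter_upwards [eventually_ge_atTop 0] with t ht using hK t ht i j

theorem DominatesSpectrum.tendsto_finiteGramian (hμ : μ < 0) (h : DominatesSpectrum μ (toC M))
    (X : Matrix (Fin d) (Fin d) ℝ) : Tendsto (finiteGramian M X) atTop (𝓝 X) := by
  have h1 := h.tendsto_exp_smul hμ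
  have h2 : Tendsto (fun t : ℝ => NormedSpace.exp (t • Mᵀ)) atTop (𝓝 0) := by
    simp only [exp_smul_transpose]
    have h2 := (continuous_id.matrix_transpose.tendsto (0 : Matrix (Fin d) (Fin d) ℝ)).comp h1
    rw [id, transpose_zero] at h2
    exact h2
  have hcont : Continuous fun Y : Matrix (Fin d) (Fin d) ℝ × Matrix (Fin d) (Fin d) ℝ =>
      X - Y.1 * X * Y.2 :=
    continuous_const.sub ((continuous_fst.matrix_mul continuous_const).matrix_mul continuous_snd)
  have h3 := (hcont.tendsto (0, 0)).comp (h1.prodMk_nhds h2)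
  rw [Matrix.zero_mul, Matrix.zero_mul, sub_zero] at h3
  exact h3

theorem exists_bound_of_continuousOn_of_tendsto {f : ℝ → ℝ} {a : ℝ}
    (hf : ContinuousOn f (Ici 0)) (hlim : Tendsto f atTop (𝓝 a)) :
    ∃ K : ℝ, 0 ≤ K ∧ ∀ t, 0 ≤ t → |f t| ≤ K := by
  obtain ⟨T, hT⟩ := eventually_atTop.1 (hlim.abs.eventually (gt_mem_nhds (lt_add_one |a|)))
  obtain ⟨K, hK⟩ := isCompact_Icc.exists_bound_of_continuousOn
    (hf.mono (Icc_subset_Ici_self : Icc 0 T ⊆ Ici 0))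
  refine ⟨max |K| (|a| + 1), le_max_of_le_left (abs_nonneg K), fun t ht => ?_⟩
  rcases le_total t T with h | h
  · exact ((hK t ⟨ht, h⟩).trans (le_abs_self K)).trans (le_max_left _ _)
  · exact (hT t h).le.trans (le_max_right _ _)

theorem continuousAt_inv_apply {N : Matrix (Fin d) (Fin d) ℝ} (hN : IsUnit N.det) (i j : Fin d) :
    ContinuousAt (fun Y : Matrix (Fin d) (Fin d) ℝ => Y⁻¹ i j) N := by
  simp only [inv_def, Ring.inverse_eq_inv', Matrix.smul_apply, smul_eq_mul]
  refine ((continuous_id.matrix_det.continuousAt).inv₀ hN.ne_zero).mul ?_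
  exact (continuous_id.matrix_adjugate.matrix_elem i j).continuousAt

/-- The entries of the inverse are continuous on `[0, ∞)` and converge at infinity, because the
limit matrix is invertible; hence they are bounded. -/
theorem exists_bound_inv_mulVec (hμ : μ < 0) (h : DominatesSpectrum μ (toC M))
    {X H : Matrix (Fin d) (Fin d) ℝ} (hlim : IsUnit (1 + H * X).det)
    (hfin : ∀ t, 0 ≤ t → IsUnit (1 + H * finiteGramian M X t).det) :
    ∃ K : ℝ, 0 ≤ K ∧ ∀ t, 0 ≤ t → ∀ v : Fin d → ℝ,
      ‖(1 + H * finiteGramian M X t)⁻¹ *ᵥ v‖ ≤ K * ‖v‖ := by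
  have hcont : Continuous fun Y : Matrix (Fin d) (Fin d) ℝ => 1 + H * Y :=
    continuous_const.add (continuous_const.matrix_mul continuous_id)
  have hentry (i j : Fin d) : ∃ K : ℝ, 0 ≤ K ∧ ∀ t, 0 ≤ t →
      |(1 + H * finiteGramian M X t)⁻¹ i j| ≤ K := by
    refine exists_bound_of_continuousOn_of_tendsto (a := (1 + H * X)⁻¹ i j) (fun t ht => ?_) ?_
    · exact (ContinuousAt.comp (f := fun t => 1 + H * finiteGramian M X t)
        (continuousAt_inv_apply (hfin t ht) i j)
        (hcont.comp (continuous_finiteGramian M X)).continuousAt).continuousWithinAt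
    · exact (continuousAt_inv_apply hlim i j).tendsto.comp
        ((hcont.tendsto X).comp (h.tendsto_finiteGramian hμ X))
  choose K hK0 hK using hentry
  refine ⟨Fintype.card (Fin d) * ∑ i, ∑ j, K i j,
    mul_nonneg (Nat.cast_nonneg _) (Finset.sum_nonneg fun i _ => Finset.sum_nonneg fun j _ =>
      hK0 i j), fun t ht v => ?_⟩
  refine norm_mulVec_le_of_entry_le (Finset.sum_nonneg fun i _ => Finset.sum_nonneg fun j _ =>
      hK0 i j) (fun i j => (hK i j t ht).trans ?_) v
  exact (Finset.single_le_sum (f := fun j => K i j) (fun j _ => hK0 i j) (Finset.mem_univ j)).trans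
    (Finset.single_le_sum (f := fun i => ∑ j, K i j)
      (fun i _ => Finset.sum_nonneg fun j _ => hK0 i j) (Finset.mem_univ i))

end Boundary

/-! ### The turnpike and the extremals around it -/

section Turnpike

variable {d q m k l : ℕ}

/-- The differential part of the stationary costate, in the coordinates of the closed loop. -/
noncomputable def turnpikeCostate (Ap : Matrix (Fin d ⊕ Fin q) (Fin d ⊕ Fin q) ℝ)
    (C : Matrix (Fin k) (Fin d ⊕ Fin q) ℝ) (yc : Fin k → ℝ) : Fin d → ℝ :=
  ((Abar Ap)⁻¹ᵀ * (Cbar Ap C)ᵀ) *ᵥ yc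

/-- The stationary input of the closed loop. -/
noncomputable def turnpikeInput (Ap : Matrix (Fin d ⊕ Fin q) (Fin d ⊕ Fin q) ℝ)
    (B : Matrix (Fin d ⊕ Fin q) (Fin m) ℝ) (C : Matrix (Fin k) (Fin d ⊕ Fin q) ℝ)
    (yc : Fin k → ℝ) : Fin m → ℝ :=
  -((Bbar Ap B)ᵀ *ᵥ turnpikeCostate Ap C yc)
    - ((inputBot B)ᵀ * Ap.toBlocks₂₂⁻¹ᵀ * (outputRight C)ᵀ) *ᵥ yc

/-- The deviation of the costate from the turnpike, with terminal value `g` at time `T`. -/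
noncomputable def costateDeviation (Ap : Matrix (Fin d ⊕ Fin q) (Fin d ⊕ Fin q) ℝ) (T : ℝ)
    (g : Fin d → ℝ) (t : ℝ) : Fin d → ℝ :=
  NormedSpace.exp ((T - t) • (Abar Ap)ᵀ) *ᵥ g

/-- The deviation of the input from the turnpike. -/
noncomputable def inputDeviation (Ap : Matrix (Fin d ⊕ Fin q) (Fin d ⊕ Fin q) ℝ)
    (B : Matrix (Fin d ⊕ Fin q) (Fin m) ℝ) (T : ℝ) (g : Fin d → ℝ) (t : ℝ) : Fin m → ℝ :=
  -((Bbar Ap B)ᵀ *ᵥ costateDeviation Ap T g t)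

/-- The deviation of the differential state from the turnpike, with initial value `ξ`. -/
noncomputable def stateDeviation (Ap : Matrix (Fin d ⊕ Fin q) (Fin d ⊕ Fin q) ℝ)
    (B : Matrix (Fin d ⊕ Fin q) (Fin m) ℝ) (ξ : Fin d → ℝ) (T : ℝ) (g : Fin d → ℝ) (t : ℝ) :
    Fin d → ℝ :=
  NormedSpace.exp (t • Abar Ap) *ᵥ
      (ξ + gramian (Abar Ap) (Bbar Ap B) *ᵥ (NormedSpace.exp (T • (Abar Ap)ᵀ) *ᵥ g))
    - gramian (Abar Ap) (Bbar Ap B) *ᵥ costateDeviation Ap T g t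

variable {Ap A P : Matrix (Fin d ⊕ Fin q) (Fin d ⊕ Fin q) ℝ}
  {B : Matrix (Fin d ⊕ Fin q) (Fin m) ℝ} {C : Matrix (Fin k) (Fin d ⊕ Fin q) ℝ}
  {F : Matrix (Fin l) (Fin d ⊕ Fin q) ℝ}
  {x₀ : Fin d ⊕ Fin q → ℝ} {yc : Fin k → ℝ} {ye : Fin l → ℝ} {μ : ℝ}

theorem hasDerivAt_costateDeviation (T : ℝ) (g : Fin d → ℝ) (t : ℝ) :
    HasDerivAt (costateDeviation Ap T g) (-((Abar Ap)ᵀ *ᵥ costateDeviation Ap T g t)) t := by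
  have h := (hasDerivAt_exp_smul_mulVec' (Abar Ap)ᵀ g (T - t)).scomp t
    ((hasDerivAt_id t).const_sub T)
  rw [neg_one_smul] at h
  exact h

/-- For the costate deviation `r` one has `(-W r)' = W Āᵀ r`, which the Lyapunov equation turns into
`-Ā W r - B̄ B̄ᵀ r`. Thus `-W r` is a particular solution, and the exponential term corrects the
initial value. -/
theorem hasDerivAt_stateDeviation (hμ : μ < 0) (h : DominatesSpectrum μ (toC (Abar Ap)))
    (ξ : Fin d → ℝ) (T : ℝ) (g : Fin d → ℝ) (t : ℝ) :
    HasDerivAt (stateDeviation Ap B ξ T g) (Abar Ap *ᵥ stateDeviation Ap B ξ T g t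
      + Bbar Ap B *ᵥ inputDeviation Ap B T g t) t := by
  refine ((hasDerivAt_exp_smul_mulVec' (Abar Ap) _ t).sub
    (hasDerivAt_mulVec _ (hasDerivAt_costateDeviation T g t))).congr_deriv ?_
  have hlyap := congrArg (· *ᵥ costateDeviation Ap T g t)
    (gramian_lyapunov hμ h (Bbar Ap B))
  simp only [add_mulVec, neg_mulVec, ← mulVec_mulVec] at hlyap
  rw [stateDeviation, inputDeviation, mulVec_sub, mulVec_neg, mulVec_neg, ← hlyap]
  abel

theorem stateDeviation_zero (ξ : Fin d → ℝ) (T : ℝ) (g : Fin d → ℝ) :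
    stateDeviation Ap B ξ T g 0 = ξ := by
  simp [stateDeviation, costateDeviation]

theorem costateDeviation_terminal (T : ℝ) (g : Fin d → ℝ) : costateDeviation Ap T g T = g := by
  simp [costateDeviation]

theorem stateDeviation_terminal (ξ : Fin d → ℝ) (T : ℝ) (g : Fin d → ℝ) :
    stateDeviation Ap B ξ T g T = NormedSpace.exp (T • Abar Ap) *ᵥ ξ
      - finiteGramian (Abar Ap) (gramian (Abar Ap) (Bbar Ap B)) T *ᵥ g := by
  rw [stateDeviation, costateDeviation_terminal, finiteGramian, sub_mulVec, mulVec_add,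
    ← mulVec_mulVec, ← mulVec_mulVec]
  abel

theorem transpose_Abar_mulVec_turnpikeCostate (hA : IsUnit (Abar Ap).det) :
    (Abar Ap)ᵀ *ᵥ turnpikeCostate Ap C yc = (Cbar Ap C)ᵀ *ᵥ yc := by
  rw [turnpikeCostate, mulVec_mulVec, ← Matrix.mul_assoc, ← transpose_mul,
    nonsing_inv_mul _ hA, transpose_one, Matrix.one_mul]

theorem turnpikeState₁_eq :
    turnpikeState₁ Ap B C yc
      = -((Abar Ap)⁻¹ *ᵥ (Bbar Ap B *ᵥ turnpikeInput Ap B C yc)) := by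
  simp only [turnpikeState₁, turnpikeInput, turnpikeCostate, mulVec_sub, mulVec_neg, add_mulVec,
    ← mulVec_mulVec]
  abel

/-- The turnpike is an equilibrium of the reduced system, so deviations obey the homogeneous
equations. -/
theorem Abar_mulVec_turnpikeState₁ (hA : IsUnit (Abar Ap).det) :
    Abar Ap *ᵥ turnpikeState₁ Ap B C yc + Bbar Ap B *ᵥ turnpikeInput Ap B C yc = 0 := by
  rw [turnpikeState₁_eq, mulVec_neg, mulVec_mulVec _ (Abar Ap), mul_nonsing_inv _ hA, one_mulVec,
    neg_add_cancel]

theorem turnpikeState_eq :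
    turnpikeState Ap B C yc
      = fullState Ap B (turnpikeState₁ Ap B C yc) (turnpikeInput Ap B C yc) := by
  rw [turnpikeState, fullState]
  congr 1
  simp only [turnpikeInput, turnpikeCostate, mulVec_sub, mulVec_neg, mulVec_add, add_mulVec,
    ← mulVec_mulVec]
  abel

theorem turnpikeControl_eq :
    turnpikeControl Ap B C P yc
      = -((Bᵀ * P) *ᵥ turnpikeState Ap B C yc) + turnpikeInput Ap B C yc := by
  simp only [turnpikeControl, turnpikeInput, turnpikeCostate, ← mulVec_mulVec]
  abel

theorem fullState_add (x₁ y₁ : Fin d → ℝ) (v w : Fin m → ℝ) :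
    fullState Ap B (x₁ + y₁) (v + w) = fullState Ap B x₁ v + fullState Ap B y₁ w := by
  rw [fullState, fullState, fullState, sumElim_add_sumElim]
  congr 1
  simp only [mulVec_add]
  abel

/-- The extremal with terminal costate deviation `g`. -/
theorem isExtremal_of_boundary {E : Matrix (Fin d ⊕ Fin q) (Fin d ⊕ Fin q) ℝ}
    (hE : E = fromBlocks 1 0 0 0) (hP : IsStabilizingSolution E A B C P)
    (hAp : Ap = closedLoop A B P) (hdet : IsUnit Ap.toBlocks₂₂.det)
    (hF : F * (fromBlocks 1 0 0 0 : Matrix (Fin d ⊕ Fin q) (Fin d ⊕ Fin q) ℝ) = F)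
    (hA : IsUnit (Abar Ap).det) (hμ : μ < 0) (h : DominatesSpectrum μ (toC (Abar Ap)))
    {T : ℝ} {ξ g : Fin d → ℝ} (hξ : turnpikeState₁ Ap B C yc + ξ = x₀ ∘ Sum.inl)
    (hg : (1 + ((Fᵀ * F).toBlocks₁₁ - P.toBlocks₁₁)
        * finiteGramian (Abar Ap) (gramian (Abar Ap) (Bbar Ap B)) T) *ᵥ g
      = ((Fᵀ * F).toBlocks₁₁ - P.toBlocks₁₁) *ᵥ
          (turnpikeState₁ Ap B C yc + NormedSpace.exp (T • Abar Ap) *ᵥ ξ)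
        - (fun i => (Fᵀ *ᵥ ye) (Sum.inl i)) - turnpikeCostate Ap C yc) :
    ∃ x' p p' : ℝ → Fin d ⊕ Fin q → ℝ, IsExtremal E A B C F x₀ yc ye T
      (fun t => turnpikeState Ap B C yc
        + fullState Ap B (stateDeviation Ap B ξ T g t) (inputDeviation Ap B T g t)) x'
      (fun t => turnpikeControl Ap B C P yc
        + (-((Bᵀ * P) *ᵥ fullState Ap B (stateDeviation Ap B ξ T g t) (inputDeviation Ap B T g t))
          + inputDeviation Ap B T g t)) p p' := by
  have hv (t : ℝ) : turnpikeInput Ap B C yc + inputDeviation Ap B T g t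
      = -(Bᵀ *ᵥ fullCostate Ap C yc (turnpikeCostate Ap C yc + costateDeviation Ap T g t)) := by
    rw [transpose_input_mulVec_fullCostate, turnpikeInput, inputDeviation, mulVec_add]
    abel
  have hx' (t : ℝ) : Abar Ap *ᵥ stateDeviation Ap B ξ T g t
        + Bbar Ap B *ᵥ inputDeviation Ap B T g t
      = Abar Ap *ᵥ (turnpikeState₁ Ap B C yc + stateDeviation Ap B ξ T g t)
        + Bbar Ap B *ᵥ (turnpikeInput Ap B C yc + inputDeviation Ap B T g t) := by
    have hs := Abar_mulVec_turnpikeState₁ (B := B) (C := C) (yc := yc) hA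
    simp only [mulVec_add]
    rw [add_add_add_comm, hs, zero_add]
  have hp' (t : ℝ) : -((Abar Ap)ᵀ *ᵥ costateDeviation Ap T g t) = (Cbar Ap C)ᵀ *ᵥ yc
      - (Abar Ap)ᵀ *ᵥ (turnpikeCostate Ap C yc + costateDeviation Ap T g t) := by
    rw [mulVec_add, transpose_Abar_mulVec_turnpikeCostate hA]
    abel
  have hx0 : turnpikeState₁ Ap B C yc + stateDeviation Ap B ξ T g 0 = x₀ ∘ Sum.inl := by
    rw [stateDeviation_zero, hξ]
  have hpT : turnpikeCostate Ap C yc + costateDeviation Ap T g T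
      = ((Fᵀ * F).toBlocks₁₁ - P.toBlocks₁₁) *ᵥ
          (turnpikeState₁ Ap B C yc + stateDeviation Ap B ξ T g T)
        - fun i => (Fᵀ *ᵥ ye) (Sum.inl i) := by
    -- `hg` is the terminal condition with the explicit terminal state inserted and the terms in `g`
    -- collected.
    rw [add_mulVec, one_mulVec, ← mulVec_mulVec] at hg
    rw [costateDeviation_terminal, stateDeviation_terminal]
    simp only [mulVec_add, mulVec_sub] at hg ⊢
    linear_combination (exp := 1) hg
  have hu (t : ℝ) : turnpikeControl Ap B C P yc
      + (-((Bᵀ * P) *ᵥ fullState Ap B (stateDeviation Ap B ξ T g t) (inputDeviation Ap B T g t))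
        + inputDeviation Ap B T g t)
      = -((Bᵀ * P) *ᵥ (turnpikeState Ap B C yc
        + fullState Ap B (stateDeviation Ap B ξ T g t) (inputDeviation Ap B T g t)))
        + (turnpikeInput Ap B C yc + inputDeviation Ap B T g t) := by
    rw [turnpikeControl_eq, mulVec_add]
    abel
  obtain ⟨x', l', hext⟩ := isExtremal_of_reduced hE hP hAp hdet hF hv
    (fun t => (hasDerivAt_stateDeviation hμ h ξ T g t).const_add _)
    (fun t => (hasDerivAt_costateDeviation T g t).const_add _) hx' hp' hx0 hpT
  simp only [fullState_add, ← turnpikeState_eq] at hext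
  simp only [hu]
  exact ⟨x', _, l', hext⟩

/-- Positivity of the cost and regularity make the boundary condition uniquely solvable. -/
theorem isUnit_boundary {E : Matrix (Fin d ⊕ Fin q) (Fin d ⊕ Fin q) ℝ}
    (hE : E = fromBlocks 1 0 0 0) (hreg : IsRegularPair E A) (hP : IsStabilizingSolution E A B C P)
    (hAp : Ap = closedLoop A B P) (hdet : IsUnit Ap.toBlocks₂₂.det)
    (hF : F * (fromBlocks 1 0 0 0 : Matrix (Fin d ⊕ Fin q) (Fin d ⊕ Fin q) ℝ) = F)
    (hA : IsUnit (Abar Ap).det) (hμ : μ < 0) (h : DominatesSpectrum μ (toC (Abar Ap)))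
    {T : ℝ} (hT : 0 ≤ T) :
    IsUnit (1 + ((Fᵀ * F).toBlocks₁₁ - P.toBlocks₁₁)
        * finiteGramian (Abar Ap) (gramian (Abar Ap) (Bbar Ap B)) T).det := by
  -- The uniqueness argument needs an interval of positive length; at `T = 0` the matrix is the
  -- identity.
  rcases hT.eq_or_lt with rfl | hT
  · rw [finiteGramian_zero, Matrix.mul_zero, add_zero, det_one]
    exact isUnit_one
  rw [isUnit_iff_ne_zero]
  intro h0
  obtain ⟨g, hg0, hg⟩ := exists_mulVec_eq_zero_iff.2 h0
  have hx0 : turnpikeState₁ Ap B C 0 = 0 := by rw [turnpikeState₁, mulVec_zero]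
  have hp0 : turnpikeCostate Ap C 0 = 0 := by rw [turnpikeCostate, mulVec_zero]
  -- A null vector is a terminal costate for zero data, so its extremal vanishes. Then `W_T g = 0`,
  -- and the boundary equation reduces to `g = 0`.
  obtain ⟨x', _, _, hext⟩ := isExtremal_of_boundary (x₀ := 0) (yc := 0) (ye := 0) (ξ := 0) (g := g)
    (T := T) hE hP hAp hdet hF hA hμ h (by rw [hx0, add_zero]; rfl) (by
      rw [hg, hx0, hp0, mulVec_zero, mulVec_zero, add_zero, mulVec_zero]
      funext i
      simp)
  have hz := hext.eq_zero_of_homogeneous hreg hT T (right_mem_Icc.2 hT.le)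
  have hz₁ : stateDeviation Ap B 0 T g T = 0 := by
    funext i
    have := congrFun hz (Sum.inl i)
    simpa [turnpikeState, hx0, fullState] using this
  rw [stateDeviation_terminal, mulVec_zero, zero_sub, neg_eq_zero] at hz₁
  rw [add_mulVec, one_mulVec, ← mulVec_mulVec, hz₁, mulVec_zero, add_zero] at hg
  exact hg0 hg

end Turnpike

/-! ### Turnpike estimates -/

section Estimate

/-- `f T t` is bounded by a multiple of `exp (μ t) + exp (μ (T - t))` for `t ∈ [0, T]`, uniformly
in `T`. -/
def IsTurnpikeBounded {ι : Type*} [Fintype ι] (μ : ℝ) (f : ℝ → ℝ → ι → ℝ) : Prop :=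
  ∃ K : ℝ, 0 ≤ K ∧ ∀ T, 0 < T → ∀ t ∈ Icc 0 T,
    ‖f T t‖ ≤ K * (Real.exp (μ * t) + Real.exp (μ * (T - t)))

variable {ι κ : Type*} [Fintype ι] [Fintype κ] {μ : ℝ} {f g : ℝ → ℝ → ι → ℝ}

theorem IsTurnpikeBounded.add (hf : IsTurnpikeBounded μ f) (hg : IsTurnpikeBounded μ g) :
    IsTurnpikeBounded μ fun T t => f T t + g T t := by
  obtain ⟨K, hK0, hK⟩ := hf
  obtain ⟨L, hL0, hL⟩ := hg
  refine ⟨K + L, add_nonneg hK0 hL0, fun T hT t ht => ?_⟩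
  rw [add_mul]
  exact (norm_add_le _ _).trans (add_le_add (hK T hT t ht) (hL T hT t ht))

theorem IsTurnpikeBounded.mulVec (hf : IsTurnpikeBounded μ f) (M : Matrix κ ι ℝ) :
    IsTurnpikeBounded μ fun T t => M *ᵥ f T t := by
  obtain ⟨K, hK0, hK⟩ := hf
  refine ⟨‖M.mulVecLin.toContinuousLinearMap‖ * K, by positivity, fun T hT t ht => ?_⟩
  rw [mul_assoc]
  exact (M.mulVecLin.toContinuousLinearMap.le_opNorm _).trans (by gcongr; exact hK T hT t ht)

theorem IsTurnpikeBounded.neg (hf : IsTurnpikeBounded μ f) :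
    IsTurnpikeBounded μ fun T t => -f T t := by
  obtain ⟨K, hK0, hK⟩ := hf
  exact ⟨K, hK0, fun T hT t ht => by rw [norm_neg]; exact hK T hT t ht⟩

theorem enorm2_le_mul_norm : ∃ c : ℝ, 0 ≤ c ∧ ∀ v : ι → ℝ, enorm2 v ≤ c * ‖v‖ :=
  ⟨‖((EuclideanSpace.equiv ι ℝ).symm : (ι → ℝ) →L[ℝ] EuclideanSpace ℝ ι)‖, norm_nonneg _,
    fun v => ((EuclideanSpace.equiv ι ℝ).symm : (ι → ℝ) →L[ℝ] EuclideanSpace ℝ ι).le_opNorm v⟩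

theorem IsTurnpikeBounded.exists_enorm2_le (hf : IsTurnpikeBounded μ f) :
    ∃ K : ℝ, 0 ≤ K ∧ ∀ T, 0 < T → ∀ t ∈ Icc 0 T,
      enorm2 (f T t) ≤ K * (Real.exp (μ * t) + Real.exp (μ * (T - t))) := by
  obtain ⟨K, hK0, hK⟩ := hf
  obtain ⟨c, hc0, hc⟩ := enorm2_le_mul_norm (ι := ι)
  refine ⟨c * K, mul_nonneg hc0 hK0, fun T hT t ht => (hc _).trans ?_⟩
  rw [mul_assoc]
  exact mul_le_mul_of_nonneg_left (hK T hT t ht) hc0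

variable {d q m : ℕ} {Ap : Matrix (Fin d ⊕ Fin q) (Fin d ⊕ Fin q) ℝ}
  {B : Matrix (Fin d ⊕ Fin q) (Fin m) ℝ}

theorem IsTurnpikeBounded.fullState {x₁ : ℝ → ℝ → Fin d → ℝ} {v : ℝ → ℝ → Fin m → ℝ}
    (hx : IsTurnpikeBounded μ x₁) (hv : IsTurnpikeBounded μ v) :
    IsTurnpikeBounded μ fun T t => fullState Ap B (x₁ T t) (v T t) := by
  obtain ⟨L, hL0, hL⟩ :=
    (((hx.mulVec Ap.toBlocks₂₁).add (hv.mulVec (inputBot B))).mulVec Ap.toBlocks₂₂⁻¹).neg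
  obtain ⟨K, hK0, hK⟩ := hx
  refine ⟨K + L, add_nonneg hK0 hL0, fun T hT t ht =>
    (pi_norm_le_iff_of_nonneg (by positivity)).2 ?_⟩
  have hK' := hK T hT t ht
  have hL' := hL T hT t ht
  rw [add_mul]
  rintro (i | i)
  · exact ((norm_le_pi_norm _ i).trans hK').trans (le_add_of_nonneg_right (by positivity))
  · exact ((norm_le_pi_norm _ i).trans hL').trans (le_add_of_nonneg_left (by positivity))

theorem isTurnpikeBounded_exp_mulVec (h : DominatesSpectrum μ (toC (Abar Ap)))
    {w : ℝ → Fin d → ℝ} {c : ℝ} (hw : ∀ T, 0 < T → ‖w T‖ ≤ c) :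
    IsTurnpikeBounded μ fun T t => NormedSpace.exp (t • Abar Ap) *ᵥ w T := by
  obtain ⟨K, hK0, hK⟩ := h.exists_bound
  have hc : 0 ≤ c := (norm_nonneg _).trans (hw 1 one_pos)
  refine ⟨K * c, mul_nonneg hK0 hc, fun T hT t ht => ((hK t ht.1 (w T)).1).trans ?_⟩
  calc K * Real.exp (μ * t) * ‖w T‖ ≤ K * Real.exp (μ * t) * c := by gcongr; exact hw T hT
    _ = K * c * Real.exp (μ * t) := by ring
    _ ≤ _ := by
      gcongr
      exact le_add_of_nonneg_right (Real.exp_pos _).le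

theorem isTurnpikeBounded_costateDeviation (h : DominatesSpectrum μ (toC (Abar Ap)))
    {w : ℝ → Fin d → ℝ} {c : ℝ} (hw : ∀ T, 0 < T → ‖w T‖ ≤ c) :
    IsTurnpikeBounded μ fun T t => costateDeviation Ap T (w T) t := by
  obtain ⟨K, hK0, hK⟩ := h.exists_bound
  have hc : 0 ≤ c := (norm_nonneg _).trans (hw 1 one_pos)
  refine ⟨K * c, mul_nonneg hK0 hc, fun T hT t ht =>
    ((hK (T - t) (sub_nonneg.2 ht.2) (w T)).2).trans ?_⟩
  calc K * Real.exp (μ * (T - t)) * ‖w T‖ ≤ K * Real.exp (μ * (T - t)) * c := by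
        gcongr; exact hw T hT
    _ = K * c * Real.exp (μ * (T - t)) := by ring
    _ ≤ _ := by
      gcongr
      exact le_add_of_nonneg_left (Real.exp_pos _).le

theorem DominatesSpectrum.exists_norm_exp_mulVec_le (hμ : μ < 0)
    (h : DominatesSpectrum μ (toC (Abar Ap))) :
    ∃ K : ℝ, 0 ≤ K ∧ ∀ T : ℝ, 0 ≤ T → ∀ v : Fin d → ℝ,
      ‖NormedSpace.exp (T • Abar Ap) *ᵥ v‖ ≤ K * ‖v‖ ∧
      ‖NormedSpace.exp (T • (Abar Ap)ᵀ) *ᵥ v‖ ≤ K * ‖v‖ := by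
  obtain ⟨K, hK0, hK⟩ := h.exists_bound
  refine ⟨K, hK0, fun T hT v => ?_⟩
  have hle : K * Real.exp (μ * T) * ‖v‖ ≤ K * ‖v‖ := by
    gcongr
    exact mul_le_of_le_one_right hK0
      (Real.exp_le_one_iff.2 (mul_nonpos_of_nonpos_of_nonneg hμ.le hT))
  exact ⟨(hK T hT v).1.trans hle, (hK T hT v).2.trans hle⟩

/-- The forward exponential, applied to a vector bounded in `T`, contributes `e^{μt}`; the costate
deviation, decaying backwards from `T`, contributes `e^{μ(T-t)}`. -/
theorem isTurnpikeBounded_deviations (hμ : μ < 0) (h : DominatesSpectrum μ (toC (Abar Ap)))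
    (ξ : Fin d → ℝ) {w : ℝ → Fin d → ℝ} {c : ℝ} (hw : ∀ T, 0 < T → ‖w T‖ ≤ c) :
    IsTurnpikeBounded μ (fun T t => inputDeviation Ap B T (w T) t) ∧
    IsTurnpikeBounded μ (fun T t => fullState Ap B (stateDeviation Ap B ξ T (w T) t)
      (inputDeviation Ap B T (w T) t)) := by
  have hq := isTurnpikeBounded_costateDeviation h hw
  have hv : IsTurnpikeBounded μ fun T t => inputDeviation Ap B T (w T) t :=
    (hq.mulVec (Bbar Ap B)ᵀ).neg
  refine ⟨hv, IsTurnpikeBounded.fullState ?_ hv⟩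
  obtain ⟨K, hK0, hK⟩ := h.exists_norm_exp_mulVec_le hμ
  set L := (gramian (Abar Ap) (Bbar Ap B)).mulVecLin.toContinuousLinearMap
  have hbound (T : ℝ) (hT : 0 < T) : ‖ξ + gramian (Abar Ap) (Bbar Ap B) *ᵥ
      (NormedSpace.exp (T • (Abar Ap)ᵀ) *ᵥ w T)‖ ≤ ‖ξ‖ + ‖L‖ * (K * c) := by
    refine (norm_add_le _ _).trans (add_le_add_right ?_ _)
    refine (L.le_opNorm _).trans (mul_le_mul_of_nonneg_left ?_ (norm_nonneg _))
    exact ((hK T hT.le (w T)).2).trans (mul_le_mul_of_nonneg_left (hw T hT) hK0)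
  have hadd := (isTurnpikeBounded_exp_mulVec h hbound).add
    (hq.mulVec (gramian (Abar Ap) (Bbar Ap B))).neg
  simp only [← sub_eq_add_neg] at hadd
  exact hadd

end Estimate

end DescriptorLQ

theorem mainTheorem2 {d q m k l : ℕ}
    (E A : Matrix (Fin d ⊕ Fin q) (Fin d ⊕ Fin q) ℝ)
    (B : Matrix (Fin d ⊕ Fin q) (Fin m) ℝ)
    (C : Matrix (Fin k) (Fin d ⊕ Fin q) ℝ)
    (F : Matrix (Fin l) (Fin d ⊕ Fin q) ℝ)
    (x₀ : Fin d ⊕ Fin q → ℝ) (yc : Fin k → ℝ) (ye : Fin l → ℝ)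
    (P : Matrix (Fin d ⊕ Fin q) (Fin d ⊕ Fin q) ℝ)
    (hE : E = Matrix.fromBlocks 1 0 0 0)
    (hreg : DescriptorLQ.IsRegularPair E A)
    (hP : DescriptorLQ.IsStabilizingSolution E A B C P)
    (hF : LinearMap.range (Matrix.mulVecLin F.transpose) ≤
      LinearMap.range (Matrix.mulVecLin E.transpose))
    (hQ : (DescriptorLQ.Qtilde A B C P).PosSemidef)
    (hW : IsUnit (1 +
      DescriptorLQ.gramian (DescriptorLQ.Abar (DescriptorLQ.closedLoop A B P))
          (DescriptorLQ.Bbar (DescriptorLQ.closedLoop A B P) B) *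
        ((F.transpose * F).toBlocks₁₁ - P.toBlocks₁₁))) :
    DescriptorLQ.spectralAbscissa (DescriptorLQ.Abar (DescriptorLQ.closedLoop A B P)) < 0 ∧
    ∃ (x : ℝ → ℝ → Fin d ⊕ Fin q → ℝ) (u : ℝ → ℝ → Fin m → ℝ),
      (∀ t₁ : ℝ, 0 < t₁ →
        DescriptorLQ.IsOptimal E A B C F x₀ yc ye t₁ (x t₁) (u t₁) ∧
        ContinuousOn (x t₁) (Set.Icc 0 t₁) ∧ ContinuousOn (u t₁) (Set.Icc 0 t₁)) ∧
      ∀ μ : ℝ, μ < 0 →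
        (DescriptorLQ.spectralAbscissa
            (DescriptorLQ.Abar (DescriptorLQ.closedLoop A B P)) < (μ : EReal) ∨
          (DescriptorLQ.spectralAbscissa
              (DescriptorLQ.Abar (DescriptorLQ.closedLoop A B P)) = (μ : EReal) ∧
            DescriptorLQ.DominantSemisimple
              (DescriptorLQ.Abar (DescriptorLQ.closedLoop A B P)))) →
        ∃ K : ℝ, 0 < K ∧ ∀ t₁ : ℝ, 0 < t₁ → ∀ t ∈ Set.Icc (0 : ℝ) t₁,
          DescriptorLQ.enorm2 (x t₁ t -
              DescriptorLQ.turnpikeState (DescriptorLQ.closedLoop A B P) B C yc) ≤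
            K * (Real.exp (μ * t) + Real.exp (μ * (t₁ - t))) ∧
          DescriptorLQ.enorm2 (u t₁ t -
              DescriptorLQ.turnpikeControl (DescriptorLQ.closedLoop A B P) B C P yc) ≤
            K * (Real.exp (μ * t) + Real.exp (μ * (t₁ - t))) := by
  open DescriptorLQ in
  set Ap := closedLoop A B P with hAp
  have hdet : IsUnit Ap.toBlocks₂₂.det := (hE ▸ hP.impulseFree).isUnit_det_toBlocks₂₂
  have hstab : ∀ z ∈ spectrum ℂ (toC (Abar Ap)), z.re < 0 := fun z hz =>
    (hE ▸ hP.stable : IsFiniteDynamicsStable (fromBlocks 1 0 0 0) Ap).re_lt_zero hdet hz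
  have habs := spectralAbscissa_lt_zero hstab
  have hA := isUnit_det_of_re_lt_zero hstab
  have hFE : F * (fromBlocks 1 0 0 0 : Matrix (Fin d ⊕ Fin q) (Fin d ⊕ Fin q) ℝ) = F :=
    hE ▸ mul_projection_eq_self hE hF
  -- The solutions must be fixed before `μ` is given, so an auxiliary rate `ν` between the abscissa
  -- and `0` serves for their construction and for the bound on `g`.
  obtain ⟨ν, hν, hν0⟩ := EReal.lt_iff_exists_real_btwn.1 habs
  replace hν0 : ν < 0 := EReal.coe_neg'.1 hν0
  have hdom := dominatesSpectrum_of_spectralAbscissa_lt hν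
  set X := gramian (Abar Ap) (Bbar Ap B)
  set H := (Fᵀ * F).toBlocks₁₁ - P.toBlocks₁₁
  have hunit (T : ℝ) (hT : 0 ≤ T) : IsUnit (1 + H * finiteGramian (Abar Ap) X T).det :=
    isUnit_boundary hE hreg hP hAp hdet hFE hA hν0 hdom hT
  have hlim : IsUnit (1 + H * X).det := by
    -- The hypothesis concerns `1 + X H`, the boundary equation `1 + H X`; their determinants agree.
    rw [det_one_add_mul_comm]
    exact (isUnit_iff_isUnit_det _).1 hW
  set xs := turnpikeState₁ Ap B C yc
  set ξ : Fin d → ℝ := x₀ ∘ Sum.inl - xs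
  set b : ℝ → Fin d → ℝ := fun T => H *ᵥ (xs + NormedSpace.exp (T • Abar Ap) *ᵥ ξ)
    - (fun i => (Fᵀ *ᵥ ye) (Sum.inl i)) - turnpikeCostate Ap C yc
  set g : ℝ → Fin d → ℝ := fun T => (1 + H * finiteGramian (Abar Ap) X T)⁻¹ *ᵥ b T
  have hg (T : ℝ) (hT : 0 ≤ T) : (1 + H * finiteGramian (Abar Ap) X T) *ᵥ g T = b T := by
    rw [mulVec_mulVec, mul_nonsing_inv _ (hunit T hT), one_mulVec]
  obtain ⟨c, hc⟩ : ∃ c, ∀ T, 0 < T → ‖g T‖ ≤ c := by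
    obtain ⟨K, hK0, hK⟩ := exists_bound_inv_mulVec hν0 hdom hlim hunit
    obtain ⟨L, hL0, hL⟩ := hdom.exists_norm_exp_mulVec_le hν0
    set N := H.mulVecLin.toContinuousLinearMap
    refine ⟨K * (‖N‖ * (‖xs‖ + L * ‖ξ‖) + ‖fun i => (Fᵀ *ᵥ ye) (Sum.inl i)‖
      + ‖turnpikeCostate Ap C yc‖), fun T hT => (hK T hT.le (b T)).trans ?_⟩
    refine mul_le_mul_of_nonneg_left ((norm_sub_le _ _).trans (add_le_add_left
      ((norm_sub_le _ _).trans (add_le_add_left ?_ _)) _)) hK0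
    refine (N.le_opNorm _).trans (mul_le_mul_of_nonneg_left ?_ (norm_nonneg _))
    exact (norm_add_le _ _).trans (add_le_add_right (hL T hT.le ξ).1 _)
  refine ⟨habs, fun T t => turnpikeState Ap B C yc
      + fullState Ap B (stateDeviation Ap B ξ T (g T) t) (inputDeviation Ap B T (g T) t),
    fun T t => turnpikeControl Ap B C P yc
      + (-((Bᵀ * P) *ᵥ fullState Ap B (stateDeviation Ap B ξ T (g T) t)
          (inputDeviation Ap B T (g T) t)) + inputDeviation Ap B T (g T) t),
    fun T hT => ?_, fun μ hμ hcase => ?_⟩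
  · obtain ⟨x', p, p', hext⟩ := isExtremal_of_boundary (x₀ := x₀) (ye := ye) hE hP hAp hdet hFE hA
      hν0 hdom (add_sub_cancel xs _) (hg T hT.le)
    exact ⟨hext.isOptimal hT.le, hext.continuous_state.continuousOn,
      hext.control_cont.continuousOn⟩
  · have hμdom : DominatesSpectrum μ (toC (Abar Ap)) := by
      rcases hcase with hlt | ⟨heq, hss⟩
      · exact dominatesSpectrum_of_spectralAbscissa_lt hlt
      · exact dominatesSpectrum_of_spectralAbscissa_eq heq hss
    obtain ⟨hv, hx⟩ := isTurnpikeBounded_deviations (B := B) hμ hμdom ξ hc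
    obtain ⟨K, hK0, hK⟩ := hx.exists_enorm2_le
    obtain ⟨L, hL0, hL⟩ := ((hx.mulVec (Bᵀ * P)).neg.add hv).exists_enorm2_le
    -- The summand `1` makes the common constant strictly positive.
    refine ⟨K + L + 1, by positivity, fun T hT t ht => ?_⟩
    simp only [add_sub_cancel_left]
    exact ⟨(hK T hT t ht).trans (by gcongr; linarith), (hL T hT t ht).trans (by gcongr; linarith)⟩
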